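/- Let $V$ be a finite-dimensional real vector space with a Lorentzian form $\ell$ of signature $(+,-,\dots,-)$, and let $C$ be one of the two closed convex cones whose union is $\{\ell(v,v)\ge 0\}$. Let $\Gamma$ be a group of affine transformations $\gamma(v)=\lambda(\gamma)v+\tau(\gamma)$ of $V$, with $\lambda(\gamma)$ linear preserving $\ell$ and $C$, acting freely and properly on $V$; let $\kappa:V\to M=V/\Gamma$ be the quotient map. $M$ is called a unipotent manifold if it is strictly causal (no nontrivial $\gamma\in\Gamma$ moves a point $v$ into $v+C$, and the past $\kappa(v-C)$ and the future $\kappa(v+C)$ of every point $\kappa(v)$ are closed near this point) and if the holonomy group $\lambda(\Gamma)$ is unipotent (upper triangular with unit diagonal in some linear basis). It is elliptic if $\Gamma$ consists of translations. Let $M$ be a nonelliptic unipotent manifold, $p=\kappa(v)\in M$, and identify $T_pM$ with $V$ by $d_v\kappa$. Let $\widehat\Gamma$ be the Zariski closure of $\Gamma$ in the group of affine transformations of $V$, and put: $T$ = the tangent space at $v$ to the orbit $\widehat\Gamma v$; $H$ = the linear span of all $(\lambda(\gamma)-1)u$ with $\gamma\in\Gamma$, $u\in V$; $U=T+H$; $L=H\cap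 H^\perp$; $W=L^\perp$. Let $\exp_p(u)=\kappa(v+u)$ be the affine exponential map $T_pM\to M$. Then $\dim L=1$, and every vector of $L$ is fixed by the holonomy group $\lambda(\Gamma)$. For each $x\in T$ there is exactly one element $\exp(x)\in\widehat\Gamma$ which is the value $g(1)$ of a continuous one-parameter subgroup $g$ of $\widehat\Gamma$ with $\frac{d}{dt}g(t)v|_{t=0}=x$; the image of $\exp$ is $\widehat\Gamma$, and $\Lambda=\{x\in T:\exp(x)\in\Gamma\}$ is a subgroup of $T$. There exist vectors $v_0\in\partial C$ generating $L$ and isotropic vectors $v_1\perp T$ with $\ell(v_0,v_1)=1$. For every such choice of $v_0,v_1$, put $N=v_1^\perp\cap W$; then $\ell$ is nondegenerate on $N$, so that the $\ell$-orthogonal projection $\pi_N$ is defined, and the following hold. (1) $v_0,v_1\in\partial C$ and $T\subseteq N$; the formula $ax=\pi_N\lambda(\exp(x))v_1$ defines a linear mapping $a:T\to N$ such that $\ell(ax,y)=\ell(x,ay)$ for $x,y\in T$ and $\ker(1+sa)=0$ for all $s\in\mathbb R$; $\Lambda$ is a lattice (a discrete subgroup spanning $T$); and in $T_pM=V$ with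 origin $v$ the group $\widehat\Gamma$ acts by the formulas of the main construction: $\exp(x)(v+u)=v+\gamma_x(u)$ for $x\in T$, $u\in V$, where $$\gamma_x(u)=u+\ell(v_0,u)\,ax-\Big(\ell(ax,u)+\tfrac12\ell(v_0,u)\,\ell(ax,ax)\Big)v_0+x-\tfrac12\ell(ax,x)\,v_0 .$$ (2) $\exp_p(\gamma_x(u))=\exp_p(u)$ for all $x\in\Lambda$ and $u\in T_pM$, and $\exp_p$ identifies $M$ with $T_pM/\Gamma$: it is a surjective covering map whose fibres are exactly the orbits of $\{\gamma_x:x\in\Lambda\}$. (3) Put $E=U^\perp\cap N$ and $M'=\exp_p(E^\perp)$. Then $V=E\oplus E^\perp$; the restriction $\Gamma'$ of $\Gamma$ to $E^\perp$ (that is, to $v+E^\perp$ with origin $v$) makes $E^\perp/\Gamma'$, with the restricted form and cone, a nonelliptic unipotent manifold; $\exp_p$ induces a topological embedding of $E^\perp/\Gamma'$ into $M$ with image $M'$; and $M=E\times M'$, that is, $(x,\exp_p(w))\mapsto\exp_p(x+w)$ for $x\in E$, $w\in E^\perp$ is a well-defined homeomorphism of $E\times M'$ onto $M$. -/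

import Mathlib

open Topology

/-- `ℓ` is a Lorentzian form: symmetric, of signature `(+,-,…,-)`. -/
def IsLorentzian {V : Type*} [AddCommGroup V] [Module ℝ V]
    (ℓ : LinearMap.BilinForm ℝ V) : Prop :=
  (∀ u w, ℓ u w = ℓ w u) ∧
    ∃ e, 0 < ℓ e e ∧ ∀ w, ℓ e w = 0 → w ≠ 0 → ℓ w w < 0

/-- `C` is one of the two closed convex round cones whose union is `{v | 0 ≤ ℓ v v}`. -/
def IsTimeCone {V : Type*} [AddCommGroup V] [Module ℝ V]
    (ℓ : LinearMap.BilinForm ℝ V) (C : Set V) : Prop :=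
  ∃ e, 0 < ℓ e e ∧ C = {w | 0 ≤ ℓ w w ∧ 0 ≤ ℓ e w}

section Quotient

variable {V : Type*} [NormedAddCommGroup V] [NormedSpace ℝ V]

/-- The orbit equivalence relation of a group `Γ` of affine transformations of `V`. -/
def orbitSetoid (Γ : Subgroup (V ≃ᵃ[ℝ] V)) : Setoid V where
  r u w := ∃ γ ∈ Γ, γ u = w
  iseqv :=
    { refl := fun u => ⟨1, Γ.one_mem, rfl⟩
      symm := by
        rintro u w ⟨γ, hγ, rfl⟩
        exact ⟨γ⁻¹, Γ.inv_mem hγ, γ.symm_apply_apply u⟩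
      trans := by
        rintro u w z ⟨γ, hγ, rfl⟩ ⟨δ, hδ, rfl⟩
        exact ⟨δ * γ, Γ.mul_mem hδ hγ, rfl⟩ }

/-- The quotient `M = V / Γ`. -/
def FlatQuotient (Γ : Subgroup (V ≃ᵃ[ℝ] V)) : Type _ := Quotient (orbitSetoid Γ)

instance (Γ : Subgroup (V ≃ᵃ[ℝ] V)) : TopologicalSpace (FlatQuotient Γ) :=
  inferInstanceAs (TopologicalSpace (Quotient (orbitSetoid Γ)))

/-- The quotient map `κ : V → V / Γ`. -/
def kappa (Γ : Subgroup (V ≃ᵃ[ℝ] V)) (v : V) : FlatQuotient Γ :=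
  Quotient.mk (orbitSetoid Γ) v

/-- The affine exponential map of `M = V / Γ` at `p = κ(v)`, the tangent space `T_p M` being
identified with `V` by `d_v κ`: the curve `t ↦ κ(v + t u)` is the affine line in `M` which has
velocity `d_v κ (u)` at `t = 0`. -/
def expAt (Γ : Subgroup (V ≃ᵃ[ℝ] V)) (v : V) (u : V) : FlatQuotient Γ :=
  kappa Γ (v + u)

/-- The two conditions which characterize the exponential map at `p = κ(v)`: each curve
`t ↦ f(t u)` is an affine line `t ↦ κ(a + t b)` in `M`, and its velocity `d_a κ (b)` at `t = 0` is
the vector `d_v κ (u)` of `T_p M`, that is, `(a, b)` is the image of `(v, u)` under some element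
of `Γ`. -/
def IsAffineExp (Γ : Subgroup (V ≃ᵃ[ℝ] V)) (v : V) (f : V → FlatQuotient Γ) : Prop :=
  ∀ u, ∃ a b : V, (∀ t : ℝ, f (t • u) = kappa Γ (a + t • b)) ∧
    ∃ γ ∈ Γ, γ v = a ∧ γ.linear u = b

theorem isAffineExp_iff (Γ : Subgroup (V ≃ᵃ[ℝ] V)) (v : V) (f : V → FlatQuotient Γ) :
    IsAffineExp Γ v f ↔ f = expAt Γ v := by
  constructor
  · intro h
    funext u
    obtain ⟨a, b, hf, γ, hγ, rfl, rfl⟩ := h u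
    have h1 := hf 1
    rw [one_smul, one_smul] at h1
    rw [h1]
    refine Quotient.sound ⟨γ⁻¹, Γ.inv_mem hγ, ?_⟩
    change γ.symm (γ v + γ.linear u) = v + u
    rw [AffineEquiv.symm_apply_eq, add_comm v u, add_comm (γ v)]
    exact (γ.map_vadd v u).symm
  · rintro rfl u
    exact ⟨v, u, fun t => rfl, 1, Γ.one_mem, rfl, rfl⟩

/-- The future `κ(v + C)` of the point `κ(v)`. -/
def future (C : Set V) (Γ : Subgroup (V ≃ᵃ[ℝ] V)) (v : V) : Set (FlatQuotient Γ) :=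
  {q | ∃ c ∈ C, q = kappa Γ (v + c)}

/-- The past `κ(v - C)` of the point `κ(v)`. -/
def past (C : Set V) (Γ : Subgroup (V ≃ᵃ[ℝ] V)) (v : V) : Set (FlatQuotient Γ) :=
  {q | ∃ c ∈ C, q = kappa Γ (v - c)}

/-- The set `A` is closed near the point `p`: its trace on some neighbourhood `U` of `p` is
closed in `U`. -/
def ClosedNear {X : Type*} [TopologicalSpace X] (A : Set X) (p : X) : Prop :=
  ∃ U ∈ 𝓝 p, IsClosed ((Subtype.val : U → X) ⁻¹' A)

/-- `M = V / Γ` is a flat complete strictly causal Lorentzian manifold: `V` is a Minkowski space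
with the cone `C`, and `Γ` is a group of affine transformations of `V` whose linear parts preserve
`ℓ` and `C`, which acts freely and properly on `V`, such that no nontrivial element of `Γ` moves
any point into its future cone (that is, `M` has no closed timelike curves), and such that
the past and the future of every point of `M` are closed near this point. -/
structure IsStrictlyCausal (ℓ : LinearMap.BilinForm ℝ V) (C : Set V)
    (Γ : Subgroup (V ≃ᵃ[ℝ] V)) : Prop where
  lorentzian : IsLorentzian ℓ
  cone : IsTimeCone ℓ C
  isometric : ∀ γ ∈ Γ, ∀ u w, ℓ (γ.linear u) (γ.linear w) = ℓ u w
  map_cone : ∀ γ ∈ Γ, γ.linear '' C = C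
  free : ∀ γ ∈ Γ, ∀ v, γ v = v → γ = 1
  proper : ∀ K : Set V, IsCompact K → {γ | γ ∈ Γ ∧ (γ '' K ∩ K).Nonempty}.Finite
  causal : ∀ γ ∈ Γ, γ ≠ 1 → ∀ v, γ v - v ∉ C
  closed_future : ∀ v, ClosedNear (future C Γ v) (kappa Γ v)
  closed_past : ∀ v, ClosedNear (past C Γ v) (kappa Γ v)

/-- The holonomy group `λ(Γ)` is unipotent: in some linear basis all its elements are
upper triangular matrices with diagonal entries equal to `1`. -/
def HasUnipotentHolonomy (Γ : Subgroup (V ≃ᵃ[ℝ] V)) : Prop :=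
  ∃ b : Module.Basis (Fin (Module.finrank ℝ V)) ℝ V, ∀ γ ∈ Γ,
    (∀ i j, j < i → LinearMap.toMatrix b b (γ.linear : V →ₗ[ℝ] V) i j = 0) ∧
    (∀ i, LinearMap.toMatrix b b (γ.linear : V →ₗ[ℝ] V) i i = 1)

/-- `M = V / Γ` is a unipotent manifold: a flat complete strictly causal Lorentzian manifold with
unipotent holonomy group. -/
def IsUnipotentManifold (ℓ : LinearMap.BilinForm ℝ V) (C : Set V)
    (Γ : Subgroup (V ≃ᵃ[ℝ] V)) : Prop :=
  IsStrictlyCausal ℓ C Γ ∧ HasUnipotentHolonomy Γ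

/-- `M = V / Γ` is elliptic: `Γ` acts by translations. -/
def IsElliptic (Γ : Subgroup (V ≃ᵃ[ℝ] V)) : Prop :=
  ∀ γ ∈ Γ, ∃ t : V, ∀ v, γ v = v + t

/-- Polynomial functions on a real vector space: the algebra of functions generated by the
linear functionals. -/
def polyFunctions (X : Type*) [AddCommGroup X] [Module ℝ X] : Subalgebra ℝ (X → ℝ) :=
  Algebra.adjoin ℝ (Set.range fun φ : Module.Dual ℝ X => (φ : X → ℝ))

/-- The pair (linear part, translation part) of an affine transformation. -/
def affCoord (g : V ≃ᵃ[ℝ] V) : (V →ₗ[ℝ] V) × V := ((g.linear : V →ₗ[ℝ] V), g 0)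

/-- The Zariski closure of `Γ` in the group of affine transformations of `V`. -/
def zariskiClosure (Γ : Subgroup (V ≃ᵃ[ℝ] V)) : Set (V ≃ᵃ[ℝ] V) :=
  {g | ∀ f ∈ polyFunctions ((V →ₗ[ℝ] V) × V),
    (∀ γ ∈ Γ, f (affCoord γ) = 0) → f (affCoord g) = 0}

/-- The subspace `T`: the tangent space at `v` to the orbit of `v` under the Zariski closure of
`Γ`, spanned by the velocities at `v` of smooth curves in the orbit. -/
def orbitTangent (Γ : Subgroup (V ≃ᵃ[ℝ] V)) (v : V) : Submodule ℝ V :=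
  Submodule.span ℝ {x | ∃ c : ℝ → V, ContDiff ℝ (⊤ : ℕ∞) c ∧ c 0 = v ∧
    (∀ t, ∃ g ∈ zariskiClosure Γ, c t = g v) ∧ deriv c 0 = x}

/-- `h = exp x`: `h` is the value at `1` of a one-parameter subgroup `g` of the Zariski closure
of `Γ` for which the curve `t ↦ g(t) v` has velocity `x` at `t = 0`. -/
def IsOrbitExp (Γ : Subgroup (V ≃ᵃ[ℝ] V)) (v x : V) (h : V ≃ᵃ[ℝ] V) : Prop :=
  ∃ g : ℝ → (V ≃ᵃ[ℝ] V), (∀ s t, g (s + t) = g s * g t) ∧ (∀ t, g t ∈ zariskiClosure Γ) ∧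
    (∀ w, Continuous fun t => g t w) ∧ HasDerivAt (fun t => g t v) x 0 ∧ g 1 = h

/-- The subspace `H`: the span of the vectors `(λ(γ) - 1) u`. -/
def holH (Γ : Subgroup (V ≃ᵃ[ℝ] V)) : Submodule ℝ V :=
  Submodule.span ℝ {w | ∃ γ ∈ Γ, ∃ u, w = γ.linear u - u}

/-- `U = T + H`. -/
def holU (Γ : Subgroup (V ≃ᵃ[ℝ] V)) (v : V) : Submodule ℝ V := orbitTangent Γ v ⊔ holH Γ

/-- `L = H ∩ H^⊥`. -/
def holL (ℓ : LinearMap.BilinForm ℝ V) (Γ : Subgroup (V ≃ᵃ[ℝ] V)) : Submodule ℝ V :=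
  holH Γ ⊓ ℓ.orthogonal (holH Γ)

/-- `W = L^⊥`. -/
def holW (ℓ : LinearMap.BilinForm ℝ V) (Γ : Subgroup (V ≃ᵃ[ℝ] V)) : Submodule ℝ V :=
  ℓ.orthogonal (holL ℓ Γ)

/-- The restriction to `v + F` of the elements of `Γ` which keep `v + F` invariant, as a group of
affine transformations of `F` (the point `v` being the origin). -/
def restrictGroup (Γ : Subgroup (V ≃ᵃ[ℝ] V)) (v : V) (F : Submodule ℝ V) :
    Subgroup (F ≃ᵃ[ℝ] F) where
  carrier := {δ | ∃ γ ∈ Γ, ∀ w : F, γ (v + w) = v + (δ w : V)}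
  mul_mem' := by
    rintro δ δ' ⟨γ, hγ, h⟩ ⟨γ', hγ', h'⟩
    refine ⟨γ * γ', Γ.mul_mem hγ hγ', fun w => ?_⟩
    change γ (γ' (v + w)) = v + (δ (δ' w) : V)
    rw [h', h]
  one_mem' := ⟨1, Γ.one_mem, fun _ => rfl⟩
  inv_mem' := by
    rintro δ ⟨γ, hγ, h⟩
    refine ⟨γ⁻¹, Γ.inv_mem hγ, fun w => ?_⟩
    change γ.symm (v + w) = v + (δ.symm w : V)
    rw [AffineEquiv.symm_apply_eq, h, AffineEquiv.apply_symm_apply]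

/-- `y` is the `ℓ`-orthogonal projection of `z` to the subspace `X`. -/
def IsOrthProj (ℓ : LinearMap.BilinForm ℝ V) (X : Submodule ℝ V) (z y : V) : Prop :=
  y ∈ X ∧ ∀ w ∈ X, ℓ (z - y) w = 0

/-! ### The main construction -/

/-- `N = v₀^⊥ ∩ v₁^⊥`. -/
def mainN (ℓ : LinearMap.BilinForm ℝ V) (v₀ v₁ : V) : Submodule ℝ V :=
  ℓ.orthogonal (Submodule.span ℝ {v₀}) ⊓ ℓ.orthogonal (Submodule.span ℝ {v₁})

/-- `λ(x) u = u + l₀(u) a x - (ℓ(a x, u) + ½ l₀(u) ℓ(a x, a x)) v₀` with `l₀(u) = ℓ(v₀, u)`. -/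
noncomputable def mainLambda (ℓ : LinearMap.BilinForm ℝ V) (v₀ : V) {T : Submodule ℝ V}
    (a : T →ₗ[ℝ] V) (x : T) (u : V) : V :=
  u + ℓ v₀ u • a x - (ℓ (a x) u + (1 / 2 : ℝ) * ℓ v₀ u * ℓ (a x) (a x)) • v₀

/-- `τ(x) = x - ½ ℓ(a x, x) v₀`. -/
noncomputable def mainTau (ℓ : LinearMap.BilinForm ℝ V) (v₀ : V) {T : Submodule ℝ V}
    (a : T →ₗ[ℝ] V) (x : T) : V :=
  (x : V) - ((1 / 2 : ℝ) * ℓ (a x) (x : V)) • v₀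

/-- `γ_x(u) = λ(x) u + τ(x)`. -/
noncomputable def mainGamma (ℓ : LinearMap.BilinForm ℝ V) (v₀ : V) {T : Submodule ℝ V}
    (a : T →ₗ[ℝ] V) (x : T) (u : V) : V :=
  mainLambda ℓ v₀ a x u + mainTau ℓ v₀ a x

/-- The parameters `v₀, v₁, T, a, Λ` satisfy all requirements of the main construction. -/
structure IsMainConstruction (ℓ : LinearMap.BilinForm ℝ V) (C : Set V) (v₀ v₁ : V)
    (T : Submodule ℝ V) (a : T →ₗ[ℝ] V) (Λ : AddSubgroup T) : Prop where
  v₀_mem : v₀ ∈ frontier C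
  v₁_mem : v₁ ∈ frontier C
  pairing : ℓ v₀ v₁ = 1
  T_le : T ≤ mainN ℓ v₀ v₁
  a_mem : ∀ x, a x ∈ mainN ℓ v₀ v₁
  a_symm : ∀ x y : T, ℓ (a x) (y : V) = ℓ (x : V) (a y)
  a_free : ∀ (s : ℝ) (x : T), (x : V) + s • a x = 0 → x = 0
  lattice_discrete : DiscreteTopology Λ
  lattice_span : Submodule.span ℝ (Λ : Set T) = ⊤

/-- An admissible choice for `M = V / Γ` at `κ(v)`: a vector `v₀` in the boundary of the cone which
generates `L`, and an isotropic vector `v₁ ⊥ T` with `ℓ(v₀, v₁) = 1`. -/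
structure IsFrame (ℓ : LinearMap.BilinForm ℝ V) (C : Set V) (Γ : Subgroup (V ≃ᵃ[ℝ] V))
    (v v₀ v₁ : V) : Prop where
  mem_frontier : v₀ ∈ frontier C
  span_eq : Submodule.span ℝ {v₀} = holL ℓ Γ
  isotropic : ℓ v₁ v₁ = 0
  perp : ∀ x ∈ orbitTangent Γ v, ℓ v₁ x = 0
  pairing : ℓ v₀ v₁ = 1

end Quotient

section LorentzAlgebra

variable {V : Type*} [AddCommGroup V] [Module ℝ V] {ℓ : LinearMap.BilinForm ℝ V}

theorem IsLorentzian.symm (h : IsLorentzian ℓ) (u w : V) : ℓ u w = ℓ w u := h.1 u w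

theorem IsLorentzian.isRefl (h : IsLorentzian ℓ) : ℓ.IsRefl := fun u w huw => by
  rw [h.symm]; exact huw

/-- The orthogonal complement of a timelike vector is negative definite. -/
theorem IsLorentzian.neg_of_orth (h : IsLorentzian ℓ) {f w : V} (hf : 0 < ℓ f f)
    (hfw : ℓ f w = 0) (hw : w ≠ 0) : ℓ w w < 0 := by
  obtain ⟨hs, e, he, hneg⟩ := h
  by_contra hq
  push Not at hq
  have hα : ℓ e f ≠ 0 := fun h0 => by
    have hf0 : f ≠ 0 := by rintro rfl; simp at hf
    linarith [hneg f h0 hf0]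
  set z := ℓ e w • f - ℓ e f • w with hz
  have hez : ℓ e z = 0 := by simp [hz]; ring
  have hzz : ℓ z z = ℓ e w ^ 2 * ℓ f f + ℓ e f ^ 2 * ℓ w w := by
    have := hs w f
    simp [hz, hfw, this]; ring
  have h1 : 0 ≤ ℓ e w ^ 2 * ℓ f f := by positivity
  have h2 : 0 ≤ ℓ e f ^ 2 * ℓ w w := by positivity
  by_cases hz0 : z = 0
  · rw [hz0] at hzz
    simp only [map_zero] at hzz
    have h3 : ℓ e w ^ 2 * ℓ f f = 0 := by linarith
    have h4 : ℓ e w = 0 := by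
      rcases mul_eq_zero.mp h3 with h | h
      · exact pow_eq_zero_iff two_ne_zero |>.mp h
      · linarith
    rw [hz, h4, zero_smul, zero_sub, neg_eq_zero] at hz0
    rcases smul_eq_zero.mp hz0 with h | h
    · exact hα h
    · exact hw h
  · linarith [hneg z hez hz0]

/-- A vector with `0 ≤ ℓ w w` orthogonal to a nonzero isotropic vector `v₀` is its multiple. -/
theorem IsLorentzian.eq_smul_of_orth (h : IsLorentzian ℓ) {v₀ w : V} (hv₀ : v₀ ≠ 0)
    (hiso : ℓ v₀ v₀ = 0) (ho : ℓ v₀ w = 0) (hw : 0 ≤ ℓ w w) : ∃ c : ℝ, w = c • v₀ := by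
  obtain ⟨hs, e, he, hneg⟩ := h
  have hev : ℓ e v₀ ≠ 0 := fun h0 => by linarith [hneg v₀ h0 hv₀]
  refine ⟨ℓ e w / ℓ e v₀, ?_⟩
  by_contra hne
  have := hneg (w - (ℓ e w / ℓ e v₀) • v₀) (by simp [hev]) (sub_ne_zero.mpr hne)
  simp [hs w v₀, ho, hiso] at this
  linarith

theorem IsLorentzian.nondegenerate (h : IsLorentzian ℓ) : ℓ.Nondegenerate := by
  have key : ∀ u, (∀ w, ℓ u w = 0) → u = 0 := fun u hu => by
    obtain ⟨hs, e, he, hneg⟩ := h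
    by_contra hne
    have := hneg u ((hs e u).trans (hu e)) hne
    rw [hu] at this
    exact lt_irrefl _ this
  exact ⟨key, fun u hu => key u fun w => (h.symm u w).trans (hu w)⟩

/-- A nonzero totally isotropic subspace is a line. -/
theorem IsLorentzian.finrank_isotropic (h : IsLorentzian ℓ) [FiniteDimensional ℝ V]
    {L : Submodule ℝ V} (hL : L ≠ ⊥) (hiso : ∀ u ∈ L, ∀ w ∈ L, ℓ u w = 0) :
    Module.finrank ℝ L = 1 := by
  obtain ⟨v₀, hv₀, hne⟩ := L.ne_bot_iff.mp hL
  refine finrank_eq_one_iff'.mpr ⟨⟨v₀, hv₀⟩, fun h0 => hne (congrArg Subtype.val h0), fun w => ?_⟩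
  obtain ⟨c, hc⟩ := h.eq_smul_of_orth hne (hiso _ hv₀ _ hv₀) (hiso _ hv₀ _ w.2)
    (hiso _ w.2 _ w.2).ge
  exact ⟨c, Subtype.ext hc.symm⟩

/-- The cone of vectors on the same side as the timelike vector `e`. -/
def timeCone (ℓ : LinearMap.BilinForm ℝ V) (e : V) : Set V := {w | 0 ≤ ℓ w w ∧ 0 ≤ ℓ e w}

theorem IsLorentzian.nonneg_of_mem_cone (h : IsLorentzian ℓ) {e u w : V} (he : 0 < ℓ e e)
    (hu : u ∈ timeCone ℓ e) (hw : w ∈ timeCone ℓ e) : 0 ≤ ℓ u w := by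
  obtain ⟨hu1, hu2⟩ := hu
  obtain ⟨hw1, hw2⟩ := hw
  rcases hu2.eq_or_lt with h0 | hα
  · by_cases hu0 : u = 0
    · simp [hu0]
    · linarith [h.neg_of_orth he h0.symm hu0]
  rcases hw2.eq_or_lt with h0 | hβ
  · by_cases hw0 : w = 0
    · simp [hw0]
    · linarith [h.neg_of_orth he h0.symm hw0]
  by_contra hneg
  push Not at hneg
  have hez : ℓ e (ℓ e w • u - ℓ e u • w) = 0 := by simp; ring
  have hzz : 0 < ℓ (ℓ e w • u - ℓ e u • w) (ℓ e w • u - ℓ e u • w) := by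
    have h1 : 0 ≤ ℓ e w ^ 2 * ℓ u u := by positivity
    have h2 : 0 ≤ ℓ e u ^ 2 * ℓ w w := by positivity
    have h3 : 0 < ℓ e w * ℓ e u * (- ℓ u w) := by
      have := neg_pos.mpr hneg
      positivity
    simp [h.symm w u]
    linarith
  have := h.neg_of_orth he hez (by rintro h0; rw [h0] at hzz; simp at hzz)
  linarith

/-- The cone can be described by each timelike vector inside it. -/
theorem IsLorentzian.timeCone_eq (h : IsLorentzian ℓ) {e f : V} (he : 0 < ℓ e e)
    (hf : 0 < ℓ f f) (hef : 0 ≤ ℓ e f) : timeCone ℓ e = timeCone ℓ f := by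
  ext w
  constructor
  · exact fun hw => ⟨hw.1, h.nonneg_of_mem_cone he ⟨hf.le, hef⟩ hw⟩
  · rintro ⟨hw1, hw2⟩
    refine ⟨hw1, ?_⟩
    by_contra hneg
    push Not at hneg
    have := h.nonneg_of_mem_cone he (u := f) (w := -w) ⟨hf.le, hef⟩
      ⟨by simpa using hw1, by simp; exact hneg.le⟩
    simp at this
    have hw0 : w ≠ 0 := by rintro rfl; simp at hneg
    linarith [h.neg_of_orth hf (le_antisymm this hw2) hw0]

/-- A subspace not containing the isotropic vector `v₀`, but orthogonal to it, is orthogonal to an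
isotropic vector `v₁` with `ℓ v₀ v₁ = 1`. -/
theorem IsLorentzian.exists_isotropic (h : IsLorentzian ℓ) [FiniteDimensional ℝ V] {v₀ : V}
    (hiso : ℓ v₀ v₀ = 0) (X : Submodule ℝ V) (hX : ∀ x ∈ X, ℓ v₀ x = 0) (hv₀ : v₀ ∉ X) :
    ∃ v₁, ℓ v₁ v₁ = 0 ∧ ℓ v₀ v₁ = 1 ∧ ∀ x ∈ X, ℓ v₁ x = 0 := by
  obtain ⟨w, hw, hw0⟩ : ∃ w ∈ ℓ.orthogonal X, ℓ v₀ w ≠ 0 := by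
    by_contra hcon
    push Not at hcon
    apply hv₀
    rw [← ℓ.orthogonal_orthogonal h.nondegenerate h.isRefl X]
    exact fun w hw => (h.symm w v₀).trans (hcon w hw)
  have hwX : ∀ x ∈ X, ℓ x w = 0 := hw
  refine ⟨(ℓ v₀ w)⁻¹ • w - ((ℓ v₀ w)⁻¹ ^ 2 * ℓ w w / 2) • v₀, ?_, ?_, fun x hx => ?_⟩
  · simp [hiso, h.symm w v₀]
    field_simp
    ring
  · simp [hiso, hw0]
  · simp [h.symm w x, hwX x hx, hX x hx]

theorem IsLorentzian.restrict (h : IsLorentzian ℓ) {F : Submodule ℝ V} {f : V} (hf : f ∈ F)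
    (hpos : 0 < ℓ f f) : IsLorentzian (ℓ.restrict F) :=
  ⟨fun _ _ => h.symm _ _, ⟨f, hf⟩, hpos, fun _ hw hne =>
    h.neg_of_orth hpos hw fun h0 => hne (Subtype.ext h0)⟩

end LorentzAlgebra

theorem isOrthProj_existsUnique {V : Type*} [NormedAddCommGroup V]
    [NormedSpace ℝ V] [FiniteDimensional ℝ V] {ℓ : LinearMap.BilinForm ℝ V} (h : IsLorentzian ℓ)
    (X : Submodule ℝ V) (hX : ∀ x ∈ X, x ≠ 0 → ℓ x x < 0) (z : V) :
    ∃! y, IsOrthProj ℓ X z y := by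
  have hd : Disjoint X (ℓ.orthogonal X) := by
    rw [Submodule.disjoint_def]
    intro x hx hx'
    by_contra hne
    have := hX x hx hne
    rw [show ℓ x x = 0 from hx' x hx] at this
    exact lt_irrefl _ this
  have hc := (ℓ.isCompl_orthogonal_iff_disjoint h.isRefl).mpr hd
  obtain ⟨y, hy, y', hy', hz⟩ := Submodule.mem_sup.mp
    (hc.sup_eq_top ▸ Submodule.mem_top : z ∈ X ⊔ ℓ.orthogonal X)
  refine ⟨y, ⟨hy, fun w hw => ?_⟩, fun x hx => ?_⟩
  · rw [← hz, add_sub_cancel_left, h.symm]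
    exact hy' w hw
  · by_contra hne
    have h1 := hX (x - y) (X.sub_mem hx.1 hy) (sub_ne_zero.mpr hne)
    have h2 : ℓ (z - x) (x - y) = 0 := hx.2 _ (X.sub_mem hx.1 hy)
    have h3 : ℓ (z - y) (x - y) = 0 := by
      rw [← hz, add_sub_cancel_left, h.symm]
      exact hy' _ (X.sub_mem hx.1 hy)
    have h4 : ℓ (x - y) (x - y) = ℓ (z - y) (x - y) - ℓ (z - x) (x - y) := by
      rw [← LinearMap.sub_apply, ← map_sub]
      congr 2
      abel
    rw [h4, h2, h3] at h1
    simp at h1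

/-! ### Unipotent groups of isometries -/

section Unipotent

variable {V : Type*} [NormedAddCommGroup V] [NormedSpace ℝ V]
  {Γ : Subgroup (V ≃ᵃ[ℝ] V)}

/-- A unipotent group acts with a fixed vector on each quotient of an invariant subspace. -/
theorem HasUnipotentHolonomy.exists_fixed_mod (h : HasUnipotentHolonomy Γ) (X Y : Submodule ℝ V)
    (hX : ∀ γ ∈ Γ, ∀ x ∈ X, γ.linear x ∈ X) (hXY : ¬ X ≤ Y) :
    ∃ x ∈ X, x ∉ Y ∧ ∀ γ ∈ Γ, γ.linear x - x ∈ Y := by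
  classical
  obtain ⟨b, hb⟩ := h
  have hex : ∃ n : ℕ, ∃ x ∈ X, x ∉ Y ∧ ∀ i, n ≤ (i : Fin _).val → b.repr x i = 0 := by
    obtain ⟨x, hx, hxY⟩ := Set.not_subset.mp hXY
    exact ⟨_, x, hx, hxY, fun i hi => absurd i.2 (not_lt.mpr hi)⟩
  obtain ⟨x, hx, hxY, hxn⟩ := Nat.find_spec hex
  refine ⟨x, hx, hxY, fun γ hγ => ?_⟩
  by_contra hcon
  have hn : Nat.find hex ≠ 0 := by
    intro h0
    apply hxY
    have : x = 0 := b.repr.map_eq_zero_iff.mp (Finsupp.ext fun i => hxn i (by omega))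
    rw [this]; exact Y.zero_mem
  refine Nat.find_min hex (m := Nat.find hex - 1) (by omega)
    ⟨γ.linear x - x, X.sub_mem (hX γ hγ x hx) hx, hcon, fun i hi => ?_⟩
  have hrepr : b.repr (γ.linear x) i =
      ∑ j, LinearMap.toMatrix b b (γ.linear : V →ₗ[ℝ] V) i j * b.repr x j := by
    have := congrFun (LinearMap.toMatrix_mulVec_repr b b (γ.linear : V →ₗ[ℝ] V) x) i
    simpa [Matrix.mulVec, dotProduct] using this.symm
  rw [map_sub, Finsupp.sub_apply, hrepr, Finset.sum_eq_single i, (hb γ hγ).2 i]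
  · ring
  · intro j _ hji
    rcases lt_or_gt_of_ne hji with hlt | hgt
    · rw [(hb γ hγ).1 i j hlt, zero_mul]
    · rw [hxn j (by have : i.val < j.val := hgt; omega), mul_zero]
  · simp

end Unipotent

section Holonomy

variable {V : Type*} [NormedAddCommGroup V] [NormedSpace ℝ V]
  {ℓ : LinearMap.BilinForm ℝ V} {Γ : Subgroup (V ≃ᵃ[ℝ] V)}

theorem linear_sub_mem_holH {γ : V ≃ᵃ[ℝ] V} (hγ : γ ∈ Γ) (u : V) : γ.linear u - u ∈ holH Γ :=
  Submodule.subset_span ⟨γ, hγ, u, rfl⟩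

theorem mem_orthogonal_holH (h : IsLorentzian ℓ)
    (hiso : ∀ γ ∈ Γ, ∀ u w, ℓ (γ.linear u) (γ.linear w) = ℓ u w) {w : V} :
    w ∈ ℓ.orthogonal (holH Γ) ↔ ∀ γ ∈ Γ, γ.linear w = w := by
  constructor
  · intro hw γ hγ
    rw [← sub_eq_zero]
    refine h.nondegenerate.2 _ fun z => ?_
    obtain ⟨u, rfl⟩ := γ.linear.surjective z
    have h1 : ℓ (γ.linear u - u) w = 0 := hw _ (linear_sub_mem_holH hγ u)
    rw [map_sub, LinearMap.sub_apply] at h1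
    rw [map_sub, hiso γ hγ]
    linarith
  · intro hw z hz
    change ℓ z w = 0
    induction hz using Submodule.span_induction with
    | mem z hz =>
      obtain ⟨γ, hγ, u, rfl⟩ := hz
      rw [map_sub, LinearMap.sub_apply, sub_eq_zero]
      conv_lhs => rw [← hw γ hγ]
      exact hiso γ hγ u w
    | zero => simp
    | add x y _ _ hx hy => simp [hx, hy]
    | smul a x _ hx => simp [hx]

theorem holL_fixed (h : IsLorentzian ℓ)
    (hiso : ∀ γ ∈ Γ, ∀ u w, ℓ (γ.linear u) (γ.linear w) = ℓ u w) :
    ∀ γ ∈ Γ, ∀ u ∈ holL ℓ Γ, γ.linear u = u :=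
  fun γ hγ _ hu => (mem_orthogonal_holH h hiso).mp hu.2 γ hγ

theorem holL_isotropic : ∀ u ∈ holL ℓ Γ, ∀ w ∈ holL ℓ Γ, ℓ u w = 0 :=
  fun u hu _ hw => hw.2 u hu.1

theorem exists_linear_ne_of_not_isElliptic (hne : ¬ IsElliptic Γ) :
    ∃ γ ∈ Γ, ∃ u, γ.linear u ≠ u := by
  by_contra hcon
  push Not at hcon
  refine hne fun γ hγ => ⟨γ 0, fun w => ?_⟩
  have := γ.map_vadd 0 w
  simp only [vadd_eq_add, add_zero] at this
  rw [this, hcon γ hγ]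

theorem holL_ne_bot (h : IsLorentzian ℓ)
    (hiso : ∀ γ ∈ Γ, ∀ u w, ℓ (γ.linear u) (γ.linear w) = ℓ u w)
    (hu : HasUnipotentHolonomy Γ) (hne : ¬ IsElliptic Γ) : holL ℓ Γ ≠ ⊥ := by
  obtain ⟨γ, hγ, u, hγu⟩ := exists_linear_ne_of_not_isElliptic hne
  obtain ⟨x, hx, hx0, hfix⟩ := hu.exists_fixed_mod (holH Γ) ⊥
    (fun γ hγ x hx => by
      have := (holH Γ).add_mem (linear_sub_mem_holH hγ x) hx
      rwa [sub_add_cancel] at this)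
    (fun hle => hγu (sub_eq_zero.mp ((Submodule.mem_bot ℝ).mp (hle (linear_sub_mem_holH hγ u)))))
  refine (holL ℓ Γ).ne_bot_iff.mpr ⟨x, ⟨hx, (mem_orthogonal_holH h hiso).mpr fun γ hγ => ?_⟩, hx0⟩
  exact sub_eq_zero.mp ((Submodule.mem_bot ℝ).mp (hfix γ hγ))

variable [FiniteDimensional ℝ V]

theorem finrank_holL (h : IsLorentzian ℓ)
    (hiso : ∀ γ ∈ Γ, ∀ u w, ℓ (γ.linear u) (γ.linear w) = ℓ u w)
    (hu : HasUnipotentHolonomy Γ) (hne : ¬ IsElliptic Γ) :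
    Module.finrank ℝ (holL ℓ Γ) = 1 :=
  h.finrank_isotropic (holL_ne_bot h hiso hu hne) holL_isotropic

/-- The holonomy group acts trivially on `W / L`. -/
theorem linear_sub_mem_holL (h : IsLorentzian ℓ)
    (hiso : ∀ γ ∈ Γ, ∀ u w, ℓ (γ.linear u) (γ.linear w) = ℓ u w)
    (hu : HasUnipotentHolonomy Γ) (hne : ¬ IsElliptic Γ) :
    ∀ γ ∈ Γ, ∀ w ∈ holW ℓ Γ, γ.linear w - w ∈ holL ℓ Γ := by
  set L := holL ℓ Γ with hL
  let X : Submodule ℝ V :=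
    { carrier := {w | w ∈ holW ℓ Γ ∧ ∀ γ ∈ Γ, γ.linear w - w ∈ L}
      add_mem' := fun {a b} ha hb => ⟨add_mem ha.1 hb.1, fun γ hγ => by
        have := L.add_mem (ha.2 γ hγ) (hb.2 γ hγ)
        rw [map_add]
        convert this using 1; abel⟩
      zero_mem' := ⟨zero_mem _, fun γ hγ => by simp⟩
      smul_mem' := fun c a ha => ⟨Submodule.smul_mem _ c ha.1, fun γ hγ => by
        have := L.smul_mem c (ha.2 γ hγ)
        rwa [map_smul, ← smul_sub]⟩ }
  have hLX : L ≤ X := fun u hu' => ⟨fun w hw => holL_isotropic w hw u hu', fun γ hγ => by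
    rw [holL_fixed h hiso γ hγ u hu', sub_self]; exact L.zero_mem⟩
  have hXinv : ∀ γ ∈ Γ, ∀ x ∈ X, γ.linear x ∈ X := fun γ hγ x hx => by
    have := X.add_mem (hLX (hx.2 γ hγ)) hx
    rwa [sub_add_cancel] at this
  have hXo : ℓ.orthogonal X ≤ L := by
    by_contra hcon
    obtain ⟨x, hx, hxL, hx'⟩ := hu.exists_fixed_mod (ℓ.orthogonal X) L
      (fun γ hγ x hx w hw => by
        change ℓ w (γ.linear x) = 0
        have h1 : ℓ ((γ⁻¹).linear w) x = 0 := hx _ (hXinv _ (Γ.inv_mem hγ) w hw)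
        rw [← hiso γ hγ] at h1
        have h2 : γ.linear ((γ⁻¹).linear w) = w := γ.linear.apply_symm_apply w
        rwa [h2] at h1) hcon
    have hxW : x ∈ holW ℓ Γ := fun w hw => hx w (hLX hw)
    have hxX : x ∈ X := ⟨hxW, hx'⟩
    have hxx : ℓ x x = 0 := hx x hxX
    obtain ⟨v₀, hv₀, hv₀ne⟩ := L.ne_bot_iff.mp (holL_ne_bot h hiso hu hne)
    obtain ⟨c, rfl⟩ := h.eq_smul_of_orth hv₀ne (holL_isotropic _ hv₀ _ hv₀) (hxW v₀ hv₀) hxx.ge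
    exact hxL (L.smul_mem c hv₀)
  have hWX : holW ℓ Γ ≤ X := by
    rw [← ℓ.orthogonal_orthogonal h.nondegenerate h.isRefl X]
    exact LinearMap.BilinForm.orthogonal_le hXo
  exact fun γ hγ w hw => (hWX hw).2 γ hγ

end Holonomy

section NullFrame

variable {V : Type*} [AddCommGroup V] [Module ℝ V] {ℓ : LinearMap.BilinForm ℝ V} {v₀ v₁ : V}

/-- A pair of isotropic vectors with product `1` in a Minkowski space. -/
structure NullPair (ℓ : LinearMap.BilinForm ℝ V) (v₀ v₁ : V) : Prop where
  lorentzian : IsLorentzian ℓ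
  iso₀ : ℓ v₀ v₀ = 0
  iso₁ : ℓ v₁ v₁ = 0
  pair : ℓ v₀ v₁ = 1

/-- The orthogonal projection to `v₀^⊥ ∩ v₁^⊥`. -/
def projN (ℓ : LinearMap.BilinForm ℝ V) (v₀ v₁ : V) : V →ₗ[ℝ] V :=
  LinearMap.id - (ℓ v₁).smulRight v₀ - (ℓ v₀).smulRight v₁

theorem projN_apply (u : V) : projN ℓ v₀ v₁ u = u - ℓ v₁ u • v₀ - ℓ v₀ u • v₁ := rfl

/-- The isometry of `V` which fixes `v₀` and is determined by the vector `b` of `v₀^⊥`. -/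
noncomputable def nullRot (ℓ : LinearMap.BilinForm ℝ V) (v₀ b u : V) : V :=
  u + ℓ v₀ u • b - (ℓ b u + (1 / 2 : ℝ) * ℓ v₀ u * ℓ b b) • v₀

namespace NullPair

variable (h : NullPair ℓ v₀ v₁)
include h

theorem symm (u w : V) : ℓ u w = ℓ w u := h.lorentzian.symm u w

theorem pair' : ℓ v₁ v₀ = 1 := (h.symm _ _).trans h.pair

theorem ne_zero : v₀ ≠ 0 := by
  intro h0
  have := h.pair
  rw [h0] at this
  simp at this

theorem sum_pos : 0 < ℓ (v₀ + v₁) (v₀ + v₁) := by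
  simp [h.iso₀, h.iso₁, h.pair, h.pair']

theorem left_projN (u : V) : ℓ v₀ (projN ℓ v₀ v₁ u) = 0 := by
  simp [projN_apply, h.iso₀, h.pair]

theorem right_projN (u : V) : ℓ v₁ (projN ℓ v₀ v₁ u) = 0 := by
  simp [projN_apply, h.iso₁, h.pair']

omit h in
theorem decomp (u : V) : u = projN ℓ v₀ v₁ u + ℓ v₁ u • v₀ + ℓ v₀ u • v₁ := by
  rw [projN_apply]; abel

theorem projN_left : projN ℓ v₀ v₁ v₀ = 0 := by
  simp [projN_apply, h.iso₀, h.pair']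

theorem projN_right : projN ℓ v₀ v₁ v₁ = 0 := by
  simp [projN_apply, h.iso₁, h.pair]

omit h in
theorem projN_eq_self {n : V} (h0 : ℓ v₀ n = 0) (h1 : ℓ v₁ n = 0) : projN ℓ v₀ v₁ n = n := by
  simp [projN_apply, h0, h1]

theorem neg {n : V} (h0 : ℓ v₀ n = 0) (h1 : ℓ v₁ n = 0) (hn : n ≠ 0) : ℓ n n < 0 :=
  h.lorentzian.neg_of_orth h.sum_pos (by simp [h0, h1]) hn

theorem left_nullRot {b : V} (hb : ℓ v₀ b = 0) (u : V) : ℓ v₀ (nullRot ℓ v₀ b u) = ℓ v₀ u := by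
  simp [nullRot, hb, h.iso₀]

theorem projN_nullRot {b : V} (hb0 : ℓ v₀ b = 0) (hb1 : ℓ v₁ b = 0) (u : V) :
    projN ℓ v₀ v₁ (nullRot ℓ v₀ b u) = projN ℓ v₀ v₁ u + ℓ v₀ u • b := by
  simp [nullRot, h.projN_left, projN_eq_self hb0 hb1]

/-- An isometry which fixes `v₀` and acts trivially on `v₀^⊥ / v₀` is a null rotation. -/
theorem eq_nullRot {g : V →ₗ[ℝ] V} (hg : ∀ u w, ℓ (g u) (g w) = ℓ u w) (h0 : g v₀ = v₀)
    (hq : ∀ w, ℓ v₀ w = 0 → ∃ c : ℝ, g w - w = c • v₀) (u : V) :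
    g u = nullRot ℓ v₀ (projN ℓ v₀ v₁ (g v₁)) u := by
  set b := projN ℓ v₀ v₁ (g v₁) with hb
  have hb0 : ℓ v₀ b = 0 := h.left_projN _
  have hb1 : ℓ v₁ b = 0 := h.right_projN _
  have hgv : ℓ v₀ (g v₁) = 1 := by
    have := hg v₀ v₁
    rwa [h0, h.pair] at this
  have h1 : g v₁ = b + ℓ v₁ (g v₁) • v₀ + v₁ := by
    have := NullPair.decomp (ℓ := ℓ) (v₀ := v₀) (v₁ := v₁) (g v₁)
    rwa [hgv, one_smul] at this
  have h2 : ℓ v₁ (g v₁) = - (1 / 2) * ℓ b b := by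
    have := hg v₁ v₁
    generalize ℓ v₁ (g v₁) = r at h1
    rw [h1] at this
    simp [h.iso₁, h.iso₀, h.pair, h.pair', h.symm b, hb0, hb1] at this
    linarith
  have h3 : ∀ n, ℓ v₀ n = 0 → ℓ v₁ n = 0 → g n = n - ℓ b n • v₀ := fun n hn0 hn1 => by
    obtain ⟨c, hc⟩ := hq n hn0
    have hc' : g n = n + c • v₀ := by rw [← hc]; abel
    have := hg n v₁
    rw [h1, hc'] at this
    simp [h.iso₀, h.pair, hb0, h.symm n, hn0, hn1] at this
    rw [hc', show c = - ℓ b n by linarith, neg_smul, sub_eq_add_neg]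
  have h4 : ℓ b (projN ℓ v₀ v₁ u) = ℓ b u := by
    simp [projN_apply, h.symm b v₀, h.symm b v₁, hb0, hb1]
  conv_lhs => rw [NullPair.decomp (ℓ := ℓ) (v₀ := v₀) (v₁ := v₁) u]
  rw [map_add, map_add, map_smul, map_smul, h0, h3 _ (h.left_projN u) (h.right_projN u), h1, h2, h4,
    nullRot, projN_apply]
  module

end NullPair

end NullFrame

section Causality

variable {V : Type*} [NormedAddCommGroup V] [NormedSpace ℝ V]
  {ℓ : LinearMap.BilinForm ℝ V} {C : Set V} {Γ : Subgroup (V ≃ᵃ[ℝ] V)} {v₀ v₁ : V}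

theorem AffineEquiv.apply_add (γ : V ≃ᵃ[ℝ] V) (p u : V) : γ (p + u) = γ p + γ.linear u := by
  rw [add_comm p, add_comm (γ p)]
  exact γ.map_vadd p u

theorem AffineEquiv.mul_linear_apply (γ δ : V ≃ᵃ[ℝ] V) (u : V) :
    (γ * δ).linear u = γ.linear (δ.linear u) := rfl

theorem AffineEquiv.mul_apply' (γ δ : V ≃ᵃ[ℝ] V) (u : V) : (γ * δ) u = γ (δ u) := rfl

/-- The nontrivial elements of `Γ` move each point by a spacelike vector. -/
theorem IsStrictlyCausal.spacelike (h : IsStrictlyCausal ℓ C Γ) {γ : V ≃ᵃ[ℝ] V} (hγ : γ ∈ Γ)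
    (hne : γ ≠ 1) (p : V) : ℓ (γ p - p) (γ p - p) < 0 := by
  obtain ⟨e, he, hC⟩ := h.cone
  by_contra hq
  push Not at hq
  by_cases h0 : 0 ≤ ℓ e (γ p - p)
  · exact h.causal γ hγ hne p (hC ▸ ⟨hq, h0⟩)
  · refine h.causal γ⁻¹ (Γ.inv_mem hγ) (inv_ne_one.mpr hne) (γ p) ?_
    have h1 : γ⁻¹ (γ p) - γ p = -(γ p - p) := by
      rw [show γ⁻¹ (γ p) = p from γ.symm_apply_apply p]; abel
    rw [h1, hC]
    refine ⟨by rwa [map_neg, map_neg, LinearMap.neg_apply, neg_neg], ?_⟩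
    rw [map_neg]
    linarith

theorem IsStrictlyCausal.eq_one (h : IsStrictlyCausal ℓ C Γ) {γ : V ≃ᵃ[ℝ] V} (hγ : γ ∈ Γ)
    (p : V) (hq : 0 ≤ ℓ (γ p - p) (γ p - p)) : γ = 1 := by
  by_contra hne
  linarith [h.spacelike hγ hne p]

/-- A null pair such that `Γ` acts by null rotations fixing `v₀`, not all of them trivial. -/
structure HolonomyFrame (ℓ : LinearMap.BilinForm ℝ V) (C : Set V) (Γ : Subgroup (V ≃ᵃ[ℝ] V))
    (v₀ v₁ : V) : Prop extends NullPair ℓ v₀ v₁ where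
  causal : IsStrictlyCausal ℓ C Γ
  linear_eq : ∀ γ ∈ Γ, ∀ u, γ.linear u = nullRot ℓ v₀ (projN ℓ v₀ v₁ (γ.linear v₁)) u
  nontrivial : ∃ γ ∈ Γ, projN ℓ v₀ v₁ (γ.linear v₁) ≠ 0

theorem holonomyFrame_of_span_eq [FiniteDimensional ℝ V] (hM : IsUnipotentManifold ℓ C Γ)
    (hne : ¬ IsElliptic Γ) (h0 : Submodule.span ℝ {v₀} = holL ℓ Γ) (h11 : ℓ v₁ v₁ = 0)
    (h01 : ℓ v₀ v₁ = 1) : HolonomyFrame ℓ C Γ v₀ v₁ := by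
  have hlor := hM.1.lorentzian
  have hiso := hM.1.isometric
  have hv₀ : v₀ ∈ holL ℓ Γ := h0 ▸ Submodule.mem_span_singleton_self v₀
  have hnp : NullPair ℓ v₀ v₁ := ⟨hlor, holL_isotropic _ hv₀ _ hv₀, h11, h01⟩
  have hlin : ∀ γ ∈ Γ, ∀ u, γ.linear u = nullRot ℓ v₀ (projN ℓ v₀ v₁ (γ.linear v₁)) u :=
    fun γ hγ u => hnp.eq_nullRot (g := (γ.linear : V →ₗ[ℝ] V)) (hiso γ hγ)
      (holL_fixed hlor hiso γ hγ v₀ hv₀) (fun w hw => by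
        have hw' : w ∈ holW ℓ Γ := fun z hz => by
          rw [← h0] at hz
          obtain ⟨c, rfl⟩ := Submodule.mem_span_singleton.mp hz
          change ℓ (c • v₀) w = 0
          simp [hw]
        have := linear_sub_mem_holL hlor hiso hM.2 hne γ hγ w hw'
        rw [← h0] at this
        obtain ⟨c, hc⟩ := Submodule.mem_span_singleton.mp this
        exact ⟨c, hc.symm⟩) u
  refine ⟨hnp, hM.1, hlin, ?_⟩
  obtain ⟨γ, hγ, u, hγu⟩ := exists_linear_ne_of_not_isElliptic hne
  refine ⟨γ, hγ, fun hb => hγu ?_⟩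
  rw [hlin γ hγ u, hb]
  simp [nullRot]

variable (ℓ v₀ v₁) in
/-- The vector `b` determining the linear part of `γ`. -/
def rotPart (γ : V ≃ᵃ[ℝ] V) : V := projN ℓ v₀ v₁ (γ.linear v₁)

namespace HolonomyFrame

variable (h : HolonomyFrame ℓ C Γ v₀ v₁)
include h

theorem left_rotPart (γ : V ≃ᵃ[ℝ] V) : ℓ v₀ (rotPart ℓ v₀ v₁ γ) = 0 := h.left_projN _

theorem right_rotPart (γ : V ≃ᵃ[ℝ] V) : ℓ v₁ (rotPart ℓ v₀ v₁ γ) = 0 := h.right_projN _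

theorem rotPart_left (γ : V ≃ᵃ[ℝ] V) : ℓ (rotPart ℓ v₀ v₁ γ) v₀ = 0 :=
  (h.symm _ _).trans (h.left_projN _)

theorem linear {γ : V ≃ᵃ[ℝ] V} (hγ : γ ∈ Γ) (u : V) :
    γ.linear u = nullRot ℓ v₀ (rotPart ℓ v₀ v₁ γ) u := h.linear_eq γ hγ u

theorem left_linear {γ : V ≃ᵃ[ℝ] V} (hγ : γ ∈ Γ) (u : V) : ℓ v₀ (γ.linear u) = ℓ v₀ u := by
  rw [h.linear hγ, h.left_nullRot (h.left_rotPart γ)]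

theorem rotPart_mul {γ δ : V ≃ᵃ[ℝ] V} (hγ : γ ∈ Γ) (hδ : δ ∈ Γ) :
    rotPart ℓ v₀ v₁ (γ * δ) = rotPart ℓ v₀ v₁ γ + rotPart ℓ v₀ v₁ δ := by
  conv_lhs => rw [rotPart, AffineEquiv.mul_linear_apply, h.linear hγ,
    h.projN_nullRot (h.left_rotPart γ) (h.right_rotPart γ), h.left_linear hδ, h.pair, one_smul]
  rw [add_comm]
  rfl

omit h in
theorem displacement_mul (γ δ : V ≃ᵃ[ℝ] V) (p : V) :
    (γ * δ) p - p = γ.linear (δ p - p) + (γ p - p) := by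
  have := γ.apply_add p (δ p - p)
  rw [add_sub_cancel] at this
  rw [AffineEquiv.mul_apply', this]
  abel

theorem left_displacement {γ : V ≃ᵃ[ℝ] V} (hγ : γ ∈ Γ) (p : V) : ℓ v₀ (γ p - p) = 0 := by
  have key : ∀ γ ∈ Γ, rotPart ℓ v₀ v₁ γ ≠ 0 → ℓ v₀ (γ p - p) = 0 := by
    intro γ hγ hb
    set b := rotPart ℓ v₀ v₁ γ with hbdef
    have hbb : ℓ b b < 0 := h.neg (h.left_rotPart γ) (h.right_rotPart γ) hb
    have hne : γ ≠ 1 := by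
      rintro rfl
      exact hb h.projN_right
    by_contra hc
    set d := γ p - p with hd
    set k := ℓ d d / (2 * ℓ b b * ℓ v₀ d) with hk
    have h1 := h.causal.spacelike hγ hne (p + k • b)
    have h2 : γ (p + k • b) - (p + k • b) = d - (k * ℓ b b) • v₀ := by
      rw [γ.apply_add, h.linear hγ, nullRot, map_smul, h.left_rotPart γ, ← hbdef, hd]
      simp only [map_smul, smul_eq_mul]
      module
    rw [h2] at h1
    simp [h.iso₀, h.symm d v₀] at h1
    have h3 : 2 * (k * ℓ b b * ℓ v₀ d) = ℓ d d := by
      have := hbb.ne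
      rw [hk]
      field_simp
    linarith
  by_cases hb : rotPart ℓ v₀ v₁ γ = 0
  · obtain ⟨δ, hδ, hδb⟩ := h.nontrivial
    have h1 := key (δ * γ) (Γ.mul_mem hδ hγ) (by
      rw [h.rotPart_mul hδ hγ, hb, add_zero]; exact hδb)
    rw [displacement_mul, map_add, h.left_linear hδ, key δ hδ hδb, add_zero] at h1
    exact h1
  · exact key γ hγ hb

theorem linear_of_orth {γ : V ≃ᵃ[ℝ] V} (hγ : γ ∈ Γ) {u : V} (hu : ℓ v₀ u = 0) :
    γ.linear u = u - ℓ (rotPart ℓ v₀ v₁ γ) u • v₀ := by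
  rw [h.linear hγ, nullRot, hu]
  simp

/-- `Γ` is commutative. -/
theorem mul_comm {γ δ : V ≃ᵃ[ℝ] V} (hγ : γ ∈ Γ) (hδ : δ ∈ Γ) : γ * δ = δ * γ := by
  rw [← mul_inv_eq_one]
  refine h.causal.eq_one (Γ.mul_mem (Γ.mul_mem hγ hδ) (Γ.inv_mem (Γ.mul_mem hδ hγ)))
    ((δ * γ) 0) (le_of_eq ?_)
  have h1 : (γ * δ * (δ * γ)⁻¹) ((δ * γ) 0) = (γ * δ) 0 := by
    rw [← AffineEquiv.mul_apply', inv_mul_cancel_right]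
  have h2 : (γ * δ) 0 - (δ * γ) 0 = ((γ * δ) 0 - 0) - ((δ * γ) 0 - 0) := by abel
  rw [h1, h2, displacement_mul, displacement_mul, h.linear_of_orth hγ (h.left_displacement hδ 0),
    h.linear_of_orth hδ (h.left_displacement hγ 0)]
  set r := ℓ (rotPart ℓ v₀ v₁ γ) (δ 0 - 0)
  set s := ℓ (rotPart ℓ v₀ v₁ δ) (γ 0 - 0)
  have h3 : δ 0 - 0 - r • v₀ + (γ 0 - 0) - (γ 0 - 0 - s • v₀ + (δ 0 - 0)) = (s - r) • v₀ := by
    module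
  rw [h3]
  simp [h.iso₀]

theorem rotPart_symm {γ δ : V ≃ᵃ[ℝ] V} (hγ : γ ∈ Γ) (hδ : δ ∈ Γ) (p : V) :
    ℓ (rotPart ℓ v₀ v₁ γ) (δ p - p) = ℓ (rotPart ℓ v₀ v₁ δ) (γ p - p) := by
  have h1 := congrArg (fun g => g p - p) (h.mul_comm hγ hδ)
  simp only [displacement_mul] at h1
  rw [h.linear_of_orth hγ (h.left_displacement hδ p),
    h.linear_of_orth hδ (h.left_displacement hγ p)] at h1
  rw [← sub_eq_zero]
  refine (smul_eq_zero.mp ?_).resolve_right h.ne_zero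
  rw [sub_smul, sub_eq_zero]
  have h2 : ∀ (r s : ℝ) (x y : V), r • v₀ - s • v₀ = (y - s • v₀ + x) - (x - r • v₀ + y) := by
    intros; module
  rw [← sub_eq_zero, h2 _ _ (δ p - p) (γ p - p), h1, sub_self]

/-- The homomorphism which is the logarithm of the translation part of `γ` at `p`. -/
noncomputable def logHom (p : V) : Additive Γ →+ V :=
  AddMonoidHom.mk' (fun γ => (γ.toMul.1 p - p) +
      ((1 / 2 : ℝ) * ℓ (rotPart ℓ v₀ v₁ γ.toMul.1) (γ.toMul.1 p - p)) • v₀) (by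
    intro γ δ
    obtain ⟨γ, hγ⟩ := γ
    obtain ⟨δ, hδ⟩ := δ
    change ((γ * δ) p - p) + ((1 / 2 : ℝ) * ℓ (rotPart ℓ v₀ v₁ (γ * δ)) ((γ * δ) p - p)) • v₀ =
      ((γ p - p) + ((1 / 2 : ℝ) * ℓ (rotPart ℓ v₀ v₁ γ) (γ p - p)) • v₀) +
      ((δ p - p) + ((1 / 2 : ℝ) * ℓ (rotPart ℓ v₀ v₁ δ) (δ p - p)) • v₀)
    rw [displacement_mul, h.linear_of_orth hγ (h.left_displacement hδ p), h.rotPart_mul hγ hδ]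
    have := h.rotPart_symm hγ hδ p
    generalize δ p - p = x at *
    generalize γ p - p = y at *
    simp only [map_add, map_sub, map_smul, LinearMap.add_apply, h.rotPart_left, smul_eq_mul]
    rw [← this]
    module)

theorem logHom_apply (p : V) (γ : V ≃ᵃ[ℝ] V) (hγ : γ ∈ Γ) :
    h.logHom p (Additive.ofMul ⟨γ, hγ⟩) =
      (γ p - p) + ((1 / 2 : ℝ) * ℓ (rotPart ℓ v₀ v₁ γ) (γ p - p)) • v₀ := rfl

/-- The homomorphism `γ ↦ b`. -/
def rotHom : Additive Γ →+ V :=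
  AddMonoidHom.mk' (fun γ => rotPart ℓ v₀ v₁ γ.toMul.1) fun γ δ =>
    h.rotPart_mul γ.toMul.2 δ.toMul.2

theorem rotHom_apply (γ : V ≃ᵃ[ℝ] V) (hγ : γ ∈ Γ) :
    h.rotHom (Additive.ofMul ⟨γ, hγ⟩) = rotPart ℓ v₀ v₁ γ := rfl

theorem left_logHom (p : V) (γ : Additive Γ) : ℓ v₀ (h.logHom p γ) = 0 := by
  obtain ⟨γ, hγ⟩ := γ
  have := h.logHom_apply p γ hγ
  change ℓ v₀ (h.logHom p (Additive.ofMul ⟨γ, hγ⟩)) = 0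
  rw [this, map_add, h.left_displacement hγ p, map_smul, h.iso₀]
  simp

/-- The motion of the `N`-component of the points `p + u` with `ℓ v₀ u = s`. -/
noncomputable def stepHom (p : V) (s : ℝ) : Additive Γ →+ V :=
  (projN ℓ v₀ v₁).toAddMonoidHom.comp (h.logHom p) +
    (s • LinearMap.id : V →ₗ[ℝ] V).toAddMonoidHom.comp h.rotHom

theorem stepHom_eq (p : V) (s : ℝ) (γ : Additive Γ) :
    h.stepHom p s γ = projN ℓ v₀ v₁ (h.logHom p γ) + s • h.rotHom γ := rfl

/-- The displacement of `p + u` is `stepHom` up to a multiple of `v₀`. -/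
theorem displacement_eq (p u : V) (γ : V ≃ᵃ[ℝ] V) (hγ : γ ∈ Γ) :
    ∃ r : ℝ, γ (p + u) - (p + u) =
      h.stepHom p (ℓ v₀ u) (Additive.ofMul ⟨γ, hγ⟩) + r • v₀ := by
  have h1 : projN ℓ v₀ v₁ (γ (p + u) - (p + u)) =
      h.stepHom p (ℓ v₀ u) (Additive.ofMul ⟨γ, hγ⟩) := by
    rw [h.stepHom_eq, h.logHom_apply, h.rotHom_apply, γ.apply_add, h.linear hγ]
    rw [show γ p + nullRot ℓ v₀ (rotPart ℓ v₀ v₁ γ) u - (p + u) =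
      (γ p - p) + (nullRot ℓ v₀ (rotPart ℓ v₀ v₁ γ) u - u) by abel]
    rw [map_add _ (γ p - p), map_sub _ (nullRot _ _ _ _),
      h.projN_nullRot (h.left_rotPart γ) (h.right_rotPart γ), map_add _ (γ p - p), map_smul,
      h.projN_left]
    module
  refine ⟨ℓ v₁ (γ (p + u) - (p + u)), ?_⟩
  have := NullPair.decomp (ℓ := ℓ) (v₀ := v₀) (v₁ := v₁) (γ (p + u) - (p + u))
  rwa [h.left_displacement hγ, zero_smul, add_zero, h1] at this

theorem stepHom_injective (p : V) (s : ℝ) : Function.Injective (h.stepHom p s) := by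
  rw [injective_iff_map_eq_zero]
  rintro ⟨γ, hγ⟩ h0
  obtain ⟨r, hr⟩ := h.displacement_eq p (s • v₁) γ hγ
  have hs : ℓ v₀ (s • v₁) = s := by simp [h.pair]
  rw [hs] at hr
  change h.stepHom p s (Additive.ofMul ⟨γ, hγ⟩) = 0 at h0
  rw [h0, zero_add] at hr
  have := h.causal.eq_one hγ (p + s • v₁) (by rw [hr]; simp [h.iso₀])
  subst this
  rfl

theorem left_stepHom (p : V) (s : ℝ) (γ : Additive Γ) : ℓ v₀ (h.stepHom p s γ) = 0 := by
  rw [stepHom_eq, map_add, h.left_projN, map_smul, show h.rotHom γ = rotPart ℓ v₀ v₁ γ.toMul.1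
    from rfl, h.left_rotPart]
  simp

theorem right_stepHom (p : V) (s : ℝ) (γ : Additive Γ) : ℓ v₁ (h.stepHom p s γ) = 0 := by
  rw [stepHom_eq, map_add, h.right_projN, map_smul, show h.rotHom γ = rotPart ℓ v₀ v₁ γ.toMul.1
    from rfl, h.right_rotPart]
  simp

end HolonomyFrame

end Causality

section Discrete

/-- A homomorphism to a vector space factors linearly through each injective homomorphism with
discrete image. -/
theorem exists_linear_of_discrete {G E E' : Type*} [AddGroup G] [NormedAddCommGroup E]
    [NormedSpace ℝ E] [FiniteDimensional ℝ E] [AddCommGroup E'] [Module ℝ E'] (y : G →+ E)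
    (z : G →+ E') (hinj : Function.Injective y) (hd : ∃ ε > 0, ∀ g, ‖y g‖ < ε → y g = 0) :
    ∃ a : E →ₗ[ℝ] E', ∀ g, a (y g) = z g := by
  classical
  let L : Submodule ℤ E := AddSubgroup.toIntSubmodule y.range
  have hdisc : DiscreteTopology L := by
    obtain ⟨ε, hε, hd⟩ := hd
    refine discreteTopology_of_isOpen_singleton_zero ?_
    rw [Metric.isOpen_singleton_iff]
    refine ⟨ε, hε, ?_⟩
    rintro ⟨_, g, rfl⟩ hg
    refine Subtype.ext (hd g ?_)
    rwa [dist_zero_right] at hg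
  let e : G ≃+ y.range := AddMonoidHom.ofInjective hinj
  let w : L →+ E' := z.comp e.symm.toAddMonoidHom
  have hw : ∀ g (hg : y g ∈ L), w ⟨y g, hg⟩ = z g := fun g hg => by
    change z (e.symm ⟨y g, hg⟩) = z g
    congr 1
    rw [AddEquiv.symm_apply_eq]
    rfl
  let b := Module.Free.chooseBasis ℤ L
  let f : Module.Free.ChooseBasisIndex ℤ L → E := fun i => (b i : E)
  have hspan : Submodule.span ℤ (Set.range f) = L := by
    have h1 : Set.range f = L.subtype '' Set.range b := by
      rw [← Set.range_comp]; rfl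
    rw [h1, ← Submodule.map_span, b.span_eq, Submodule.map_top, Submodule.range_subtype]
  have hli : LinearIndependent ℝ f := by
    rw [linearIndependent_iff_card_eq_finrank_span,
      Real.finrank_eq_int_finrank_of_discrete (by rw [hspan]; exact hdisc), Set.finrank, hspan,
      Module.finrank_eq_card_chooseBasisIndex]
  obtain ⟨a, ha⟩ := LinearMap.exists_extend ((Module.Basis.span hli).constr ℝ fun i => w (b i))
  have hab : ∀ i, a (b i) = w (b i) := fun i => by
    have h1 := LinearMap.congr_fun ha (Module.Basis.span hli i)
    rw [Module.Basis.constr_basis, LinearMap.comp_apply, Submodule.subtype_apply,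
      Module.Basis.span_apply] at h1
    exact h1
  have hmap : (a.restrictScalars ℤ).comp L.subtype = w.toIntLinearMap := b.ext hab
  refine ⟨a, fun g => ?_⟩
  rw [← hw g ⟨g, rfl⟩]
  exact LinearMap.congr_fun hmap ⟨y g, ⟨g, rfl⟩⟩

end Discrete

section Closed

variable {V : Type*} [NormedAddCommGroup V] [NormedSpace ℝ V]
  {ℓ : LinearMap.BilinForm ℝ V} {C : Set V} {Γ : Subgroup (V ≃ᵃ[ℝ] V)} {v₀ v₁ : V}

theorem continuous_kappa (Γ : Subgroup (V ≃ᵃ[ℝ] V)) : Continuous (kappa Γ) :=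
  continuous_quotient_mk'

theorem kappa_eq_iff {u w : V} : kappa Γ u = kappa Γ w ↔ ∃ γ ∈ Γ, γ u = w :=
  Quotient.eq (r := orbitSetoid Γ)

theorem ClosedNear.exists_preimage {A : Set (FlatQuotient Γ)} {p : V}
    (h : ClosedNear A (kappa Γ p)) :
    ∃ O ∈ 𝓝 p, ∀ x ∈ O, x ∈ closure (kappa Γ ⁻¹' A) → x ∈ kappa Γ ⁻¹' A := by
  obtain ⟨U, hU, hcl⟩ := h
  obtain ⟨t, ht, htA⟩ := isClosed_induced_iff.mp hcl
  have hUA : ∀ q ∈ U, q ∈ t ↔ q ∈ A := fun q hq => by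
    have := Set.ext_iff.mp htA ⟨q, hq⟩
    exact this
  refine ⟨kappa Γ ⁻¹' interior U, (continuous_kappa Γ).continuousAt.preimage_mem_nhds
    (interior_mem_nhds.mpr hU), fun x hx hxcl => ?_⟩
  refine (hUA _ (interior_subset hx)).mp ?_
  have hopen : IsOpen (kappa Γ ⁻¹' interior U) := isOpen_interior.preimage (continuous_kappa Γ)
  have h1 := closure_mono (t := kappa Γ ⁻¹' t) (by
    rintro z ⟨hz, hz'⟩
    exact (hUA _ (interior_subset hz)).mpr hz') (hopen.inter_closure ⟨hx, hxcl⟩)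
  rwa [(ht.preimage (continuous_kappa Γ)).closure_eq] at h1

variable [FiniteDimensional ℝ V]

theorem continuous_bilin (ℓ : LinearMap.BilinForm ℝ V) {X : Type*} [TopologicalSpace X]
    {f g : X → V} (hf : Continuous f) (hg : Continuous g) : Continuous fun x => ℓ (f x) (g x) :=
  (LinearMap.toContinuousBilinearMap ℓ).continuous₂.comp (hf.prodMk hg)

/-- If a union of future cones with countably many vertices in a null hyperplane, which tend along
this hyperplane to the past infinity, is closed near one of them, then the hyperplane is a line. -/
theorem null_hyperplane_eq_line (h : IsLorentzian ℓ) {e : V} (hv₀ : ℓ v₀ v₀ = 0)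
    (hev₀ : ℓ e v₀ = 1) {P : Set V} (hP : P.Countable) {p : V} (hPp : ∀ q ∈ P, ℓ v₀ (q - p) = 0)
    (hlim : ∀ ε > 0, ∀ R : ℝ, ∃ q ∈ P, ∃ d : V, ∃ r : ℝ, q = p + d + r • v₀ ∧ ‖d‖ < ε ∧ r < -R)
    {O : Set V} (hO : O ∈ 𝓝 p)
    (hcl : ∀ x ∈ O, x ∈ closure {x | ∃ q ∈ P, x - q ∈ timeCone ℓ e} →
      ∃ q ∈ P, x - q ∈ timeCone ℓ e) {w : V} (hw : ℓ v₀ w = 0) : ∃ c : ℝ, w = c • v₀ := by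
  have hne : v₀ ≠ 0 := by rintro rfl; simp at hev₀
  have hv₀e : ℓ v₀ e = 1 := (h.symm _ _).trans hev₀
  have hhalf : ∀ x, 0 < ℓ v₀ (x - p) → ∃ q ∈ P, x - q ∈ timeCone ℓ e := by
    intro x hx
    have hc1 : Continuous fun d : V => ℓ (x - p - d) (x - p - d) :=
      continuous_bilin ℓ (by fun_prop) (by fun_prop)
    have hc2 : Continuous fun d : V => ℓ e (x - p - d) :=
      continuous_bilin ℓ continuous_const (by fun_prop)
    have hc3 : Continuous fun d : V => ℓ v₀ (x - p - d) :=
      continuous_bilin ℓ continuous_const (by fun_prop)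
    have h1 := hc1.continuousAt.eventually (lt_mem_nhds (sub_one_lt (ℓ (x - p - 0) (x - p - 0))))
    have h2 := hc2.continuousAt.eventually (lt_mem_nhds (sub_one_lt (ℓ e (x - p - 0))))
    have h3 := hc3.continuousAt.eventually (lt_mem_nhds
      (show ℓ v₀ (x - p) / 2 < ℓ v₀ (x - p - 0) by rw [sub_zero]; linarith))
    obtain ⟨ε, hε, hball⟩ := Metric.eventually_nhds_iff.mp (h1.and (h2.and h3))
    set A := ℓ (x - p - 0) (x - p - 0) - 1
    set B := ℓ e (x - p - 0) - 1
    set δ := ℓ v₀ (x - p)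
    obtain ⟨q, hq, d, r, rfl, hd, hr⟩ := hlim ε hε (|A| / δ + |B|)
    obtain ⟨g1, g2, g3⟩ := hball (y := d) (by rwa [dist_zero_right])
    refine ⟨_, hq, ?_, ?_⟩
    · have h4 : ℓ (x - (p + d + r • v₀)) (x - (p + d + r • v₀)) =
          ℓ (x - p - d) (x - p - d) - 2 * r * ℓ v₀ (x - p - d) := by
        rw [show x - (p + d + r • v₀) = (x - p - d) - r • v₀ by abel]
        generalize x - p - d = z
        simp [hv₀, h.symm z v₀]
        ring
      rw [h4]
      have h5 : |A| ≤ -r * δ := by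
        rw [← div_le_iff₀ hx]
        have := abs_nonneg B
        linarith
      have h6 : -r * δ ≤ - r * (2 * ℓ v₀ (x - p - d)) := by
        refine mul_le_mul_of_nonneg_left (by linarith) ?_
        have := abs_nonneg B
        have : 0 ≤ |A| / δ := by positivity
        linarith
      have := neg_abs_le A
      linarith
    · rw [show x - (p + d + r • v₀) = (x - p - d) - r • v₀ by abel, map_sub, map_smul, hev₀]
      have := neg_abs_le B
      have : 0 ≤ |A| / δ := by positivity
      simp only [smul_eq_mul, mul_one]
      linarith
  have hplane : ∀ x ∈ O, ℓ v₀ (x - p) = 0 → ∃ q ∈ P, ∃ c : ℝ, x - q = c • v₀ := by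
    intro x hx hx0
    obtain ⟨q, hq, hqC⟩ := hcl x hx (by
      have ht : Filter.Tendsto (fun t : ℝ => x + t • e) (𝓝[>] 0) (𝓝 x) := by
        have : Continuous fun t : ℝ => x + t • e := by fun_prop
        have := this.tendsto 0
        rw [zero_smul, add_zero] at this
        exact this.mono_left nhdsWithin_le_nhds
      refine mem_closure_of_tendsto ht ?_
      filter_upwards [self_mem_nhdsWithin] with t (ht : 0 < t)
      refine hhalf _ ?_
      rw [show x + t • e - p = (x - p) + t • e by abel, map_add, hx0, map_smul, hv₀e]
      simpa using ht)
    refine ⟨q, hq, h.eq_smul_of_orth hne hv₀ ?_ hqC.1⟩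
    rw [show x - q = (x - p) - (q - p) by abel, map_sub, hx0, hPp q hq, sub_zero]
  by_contra hcon
  have hO' : {t : ℝ | p + t • w ∈ O} ∈ 𝓝 (0 : ℝ) := by
    have : Continuous fun t : ℝ => p + t • w := by fun_prop
    refine this.continuousAt.preimage_mem_nhds ?_
    simpa using hO
  have hcount : {t : ℝ | p + t • w ∈ O}.Countable := by
    have hsub : {t : ℝ | p + t • w ∈ O} ⊆
        ⋃ q ∈ P, {t : ℝ | ∃ c : ℝ, p + t • w - q = c • v₀} := fun t ht => by
      obtain ⟨q, hq, hc⟩ := hplane _ ht (by simp [hw])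
      exact Set.mem_biUnion hq hc
    refine (hP.biUnion fun q _ => Set.Subsingleton.countable ?_).mono hsub
    rintro t ⟨c, hc⟩ t' ⟨c', hc'⟩
    by_contra htt
    refine hcon ⟨(t - t')⁻¹ * (c - c'), ?_⟩
    have h1 : (t - t') • w = (c - c') • v₀ := by
      rw [sub_smul c, ← hc, ← hc']; module
    rw [mul_smul, ← h1, inv_smul_smul₀ (sub_ne_zero.mpr htt)]
  obtain ⟨t, ht, ht'⟩ := (hcount.dense_compl ℝ).inter_nhds_nonempty hO'
  exact ht ht'

theorem IsStrictlyCausal.countable (h : IsStrictlyCausal ℓ C Γ) :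
    {γ : V ≃ᵃ[ℝ] V | γ ∈ Γ}.Countable := by
  have : {γ : V ≃ᵃ[ℝ] V | γ ∈ Γ} ⊆ ⋃ n : ℕ, {γ | γ ∈ Γ ∧
      (γ '' Metric.closedBall (0 : V) n ∩ Metric.closedBall (0 : V) n).Nonempty} := fun γ hγ => by
    obtain ⟨n, hn⟩ := exists_nat_ge ‖γ 0‖
    refine Set.mem_iUnion.mpr ⟨n, hγ, γ 0, ⟨0, by simp, rfl⟩, by simpa using hn⟩
  refine (Set.countable_iUnion fun n => ?_).mono this
  exact (h.proper _ (isCompact_closedBall _ _)).countable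

namespace HolonomyFrame

variable (h : HolonomyFrame ℓ C Γ v₀ v₁)
include h

/-- Short steps, if any, are accompanied by large displacements along `v₀`. -/
theorem exists_large_displacement (p : V) (s : ℝ)
    (hd : ∀ ε > 0, ∃ γ, ‖h.stepHom p s γ‖ < ε ∧ h.stepHom p s γ ≠ 0) (ε : ℝ) (hε : 0 < ε) (R : ℝ) :
    ∃ γ, ∃ hγ : γ ∈ Γ, ∃ r : ℝ, ‖h.stepHom p s (Additive.ofMul ⟨γ, hγ⟩)‖ < ε ∧
      γ (p + s • v₁) = p + s • v₁ + h.stepHom p s (Additive.ofMul ⟨γ, hγ⟩) + r • v₀ ∧ R < |r| := by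
  set q := p + s • v₁ with hq
  set K := Metric.closedBall q (1 + R * ‖v₀‖) with hK
  have hF := h.causal.proper K (isCompact_closedBall _ _)
  have hev : ∀ᶠ η in 𝓝[>] (0 : ℝ), ∀ γ ∈ {γ | γ ∈ Γ ∧ (γ '' K ∩ K).Nonempty}, ∀ hγ : γ ∈ Γ,
      h.stepHom p s (Additive.ofMul ⟨γ, hγ⟩) ≠ 0 →
        η < ‖h.stepHom p s (Additive.ofMul ⟨γ, hγ⟩)‖ := by
    rw [Filter.eventually_all_finite hF]
    intro γ hγ
    by_cases h0 : h.stepHom p s (Additive.ofMul ⟨γ, hγ.1⟩) = 0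
    · exact Filter.Eventually.of_forall fun η _ hne => absurd h0 hne
    · filter_upwards [nhdsWithin_le_nhds (gt_mem_nhds (norm_pos_iff.mpr h0))] with η hη _ _
      exact hη
  obtain ⟨η, ⟨hη1, hη2⟩, hη3⟩ := ((hev.and (nhdsWithin_le_nhds (gt_mem_nhds
    (lt_min hε one_pos)))).and self_mem_nhdsWithin).exists
  obtain ⟨⟨γ, hγ⟩, hγ1, hγ2⟩ := hd η hη3
  change ‖h.stepHom p s (Additive.ofMul ⟨γ, hγ⟩)‖ < η at hγ1
  change h.stepHom p s (Additive.ofMul ⟨γ, hγ⟩) ≠ 0 at hγ2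
  obtain ⟨r, hr⟩ := h.displacement_eq p (s • v₁) γ hγ
  rw [← hq, map_smul, h.pair, smul_eq_mul, mul_one, sub_eq_iff_eq_add] at hr
  refine ⟨γ, hγ, r, hγ1.trans (hη2.trans_le (min_le_left _ _)), ?_, ?_⟩
  · rw [hr]; abel
  · by_contra hle
    push Not at hle
    have hR : 0 ≤ R := (abs_nonneg r).trans hle
    refine absurd (hη1 γ ⟨hγ, γ q, ⟨q, Metric.mem_closedBall_self (by positivity), rfl⟩, ?_⟩ hγ hγ2)
      (not_lt.mpr hγ1.le)
    rw [hK, mem_closedBall_iff_norm, hr, add_sub_cancel_right]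
    refine (norm_add_le _ _).trans (add_le_add
      (hγ1.trans (hη2.trans_le (min_le_right _ _))).le ?_)
    rw [norm_smul, Real.norm_eq_abs]
    exact mul_le_mul_of_nonneg_right hle (norm_nonneg _)

theorem stepHom_discrete (p : V) (s : ℝ) :
    ∃ ε > 0, ∀ γ, ‖h.stepHom p s γ‖ < ε → h.stepHom p s γ = 0 := by
  by_contra hcon
  push Not at hcon
  obtain ⟨e, he, hC⟩ := h.causal.cone
  have hC' : C = timeCone ℓ e := hC
  set q := p + s • v₁ with hq
  set k := ℓ e v₀ with hk
  have hk0 : k ≠ 0 := fun h0 => by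
    have := h.lorentzian.neg_of_orth he h0 h.ne_zero
    rw [h.iso₀] at this
    exact lt_irrefl _ this
  set P : Set V := {x | ∃ γ ∈ Γ, x = γ q} with hP
  have hPc : P.Countable := by
    refine (h.causal.countable.image fun γ => γ q).mono ?_
    rintro x ⟨γ, hγ, rfl⟩
    exact ⟨γ, hγ, rfl⟩
  have hPq : ∀ x ∈ P, ℓ v₀ (x - q) = 0 := by
    rintro x ⟨γ, hγ, rfl⟩
    exact h.left_displacement hγ q
  have hcontra : (∀ w, ℓ v₀ w = 0 → ∃ c : ℝ, w = c • v₀) → False := by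
    intro hline
    obtain ⟨γ, -, hγ⟩ := hcon 1 one_pos
    obtain ⟨c, hc⟩ := hline _ (h.left_stepHom p s γ)
    have := h.right_stepHom p s γ
    rw [hc, map_smul, h.pair', smul_eq_mul, mul_one] at this
    exact hγ (by rw [hc, this, zero_smul])
  have hfut : kappa Γ ⁻¹' future C Γ q = {x | ∃ y ∈ P, x - y ∈ timeCone ℓ e} := by
    ext x
    constructor
    · rintro ⟨c, hc, hx⟩
      obtain ⟨γ, hγ, rfl⟩ := kappa_eq_iff.mp hx.symm
      refine ⟨γ q, ⟨γ, hγ, rfl⟩, ?_⟩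
      rw [γ.apply_add, add_sub_cancel_left, ← hC', ← h.causal.map_cone γ hγ]
      exact ⟨c, hc, rfl⟩
    · rintro ⟨_, ⟨γ, hγ, rfl⟩, hx⟩
      rw [← hC', ← h.causal.map_cone γ hγ] at hx
      obtain ⟨c, hc, hx⟩ := hx
      refine ⟨c, hc, (kappa_eq_iff.mpr ⟨γ, hγ, ?_⟩).symm⟩
      rw [γ.apply_add, hx, add_sub_cancel]
  have hneg : ∀ x, x ∈ timeCone ℓ (-e) ↔ -x ∈ C := fun x => by
    rw [hC']
    simp [timeCone]
  have hpast : kappa Γ ⁻¹' past C Γ q = {x | ∃ y ∈ P, x - y ∈ timeCone ℓ (-e)} := by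
    ext x
    constructor
    · rintro ⟨c, hc, hx⟩
      obtain ⟨γ, hγ, rfl⟩ := kappa_eq_iff.mp hx.symm
      refine ⟨γ q, ⟨γ, hγ, rfl⟩, ?_⟩
      rw [hneg, sub_eq_add_neg q c, γ.apply_add q (-c), add_sub_cancel_left,
        ← h.causal.map_cone γ hγ, map_neg, neg_neg]
      exact ⟨c, hc, rfl⟩
    · rintro ⟨_, ⟨γ, hγ, rfl⟩, hx⟩
      rw [hneg, ← h.causal.map_cone γ hγ] at hx
      obtain ⟨c, hc, hx⟩ := hx
      refine ⟨c, hc, (kappa_eq_iff.mpr ⟨γ, hγ, ?_⟩).symm⟩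
      rw [sub_eq_add_neg, γ.apply_add, map_neg, hx]
      abel
  have hlarge : ∀ ε > 0, ∀ R : ℝ, ∃ x ∈ P, ∃ d : V, ∃ r : ℝ,
      x = q + d + r • v₀ ∧ ‖d‖ < ε ∧ R < |r * k| := by
    intro ε hε R
    obtain ⟨γ, hγ, r, h1, h2, h3⟩ := h.exists_large_displacement p s
      (fun ε hε => by simpa using hcon ε hε) ε hε (R / |k|)
    refine ⟨γ q, ⟨γ, hγ, rfl⟩, _, r, h2, h1, ?_⟩
    rwa [div_lt_iff₀ (abs_pos.mpr hk0), ← abs_mul] at h3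
  by_cases hcase : ∀ ε > 0, ∀ R : ℝ, ∃ x ∈ P, ∃ d : V, ∃ r : ℝ,
      x = q + d + r • v₀ ∧ ‖d‖ < ε ∧ r * k < -R
  · obtain ⟨O, hO, hcl⟩ := (h.causal.closed_future q).exists_preimage
    rw [hfut] at hcl
    refine hcontra fun w hw => ?_
    obtain ⟨c, hc⟩ := null_hyperplane_eq_line (v₀ := k⁻¹ • v₀) (e := e) (P := P) (p := q) (w := w)
      h.lorentzian (by simp [h.iso₀]) (by simp [← hk, hk0]) hPc
      (fun x hx => by simp [hPq x hx]) (fun ε hε R => by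
        obtain ⟨x, hx, d, r, h1, h2, h3⟩ := hcase ε hε R
        refine ⟨x, hx, d, r * k, ?_, h2, h3⟩
        rw [h1, mul_smul, smul_inv_smul₀ hk0]) hO hcl (by simp [hw])
    exact ⟨c * k⁻¹, by rw [hc, mul_smul]⟩
  · push Not at hcase
    obtain ⟨ε₀, hε₀, R₀, hcase⟩ := hcase
    obtain ⟨O, hO, hcl⟩ := (h.causal.closed_past q).exists_preimage
    rw [hpast] at hcl
    refine hcontra fun w hw => ?_
    obtain ⟨c, hc⟩ := null_hyperplane_eq_line (v₀ := (-k⁻¹) • v₀) (e := -e) (P := P) (p := q)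
      (w := w) h.lorentzian (by simp [h.iso₀]) (by simp [← hk, hk0]) hPc
      (fun x hx => by simp [hPq x hx]) (fun ε hε R => by
        obtain ⟨x, hx, d, r, h1, h2, h3⟩ := hlarge (min ε ε₀) (lt_min hε hε₀) (max R R₀)
        have h4 := hcase x hx d r h1 (h2.trans_le (min_le_right _ _))
        refine ⟨x, hx, d, -(r * k), ?_, h2.trans_le (min_le_left _ _), ?_⟩
        · rw [h1, smul_smul]
          congr 2
          field_simp
        · rcases lt_abs.mp h3 with h5 | h5
          · linarith [le_max_left R R₀]
          · linarith [le_max_right R R₀]) hO hcl (by simp [hw])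
    exact ⟨c * -k⁻¹, by rw [hc, mul_smul]⟩

end HolonomyFrame

end Closed

section Polynomial

variable {X Y : Type*} [AddCommGroup X] [Module ℝ X] [AddCommGroup Y] [Module ℝ Y]

theorem dual_mem_polyFunctions (φ : Module.Dual ℝ X) : (φ : X → ℝ) ∈ polyFunctions X :=
  Algebra.subset_adjoin ⟨φ, rfl⟩

theorem const_mem_polyFunctions (c : ℝ) : (fun _ => c) ∈ polyFunctions X :=
  (polyFunctions X).algebraMap_mem c

theorem comp_mem_polyFunctions {f : Y → ℝ} (hf : f ∈ polyFunctions Y) {G : X → Y}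
    (hG : ∀ φ : Module.Dual ℝ Y, (fun x => φ (G x)) ∈ polyFunctions X) :
    (fun x => f (G x)) ∈ polyFunctions X := by
  induction hf using Algebra.adjoin_induction with
  | mem f hf =>
    obtain ⟨φ, rfl⟩ := hf
    exact hG φ
  | algebraMap r => exact const_mem_polyFunctions r
  | add f g _ _ hf hg => exact (polyFunctions X).add_mem hf hg
  | mul f g _ _ hf hg => exact (polyFunctions X).mul_mem hf hg

theorem quadratic_mem_polyFunctions [FiniteDimensional ℝ X] (B : X →ₗ[ℝ] X →ₗ[ℝ] ℝ) :
    (fun x => B x x) ∈ polyFunctions X := by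
  let b := Module.finBasis ℝ X
  have : (fun x => B x x) = ∑ i, (b.coord i : X → ℝ) * (B (b i) : X → ℝ) := by
    funext x
    have hB : B x = ∑ i, b.repr x i • B (b i) := by
      conv_lhs => rw [← b.sum_repr x, map_sum]
      simp only [map_smul]
    rw [hB]
    simp
  rw [this]
  exact Subalgebra.sum_mem _ fun i _ =>
    Subalgebra.mul_mem _ (dual_mem_polyFunctions _) (dual_mem_polyFunctions _)

theorem exists_polynomial_on_line {f : X → ℝ} (hf : f ∈ polyFunctions X) (u x : X) :
    ∃ P : Polynomial ℝ, ∀ t : ℝ, f (u + t • x) = P.eval t := by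
  induction hf using Algebra.adjoin_induction with
  | mem f hf =>
    obtain ⟨φ, rfl⟩ := hf
    exact ⟨Polynomial.C (φ u) + Polynomial.X * Polynomial.C (φ x), fun t => by simp; ring⟩
  | algebraMap r => exact ⟨Polynomial.C r, fun t => by simp⟩
  | add f g _ _ hf hg =>
    obtain ⟨P, hP⟩ := hf
    obtain ⟨Q, hQ⟩ := hg
    exact ⟨P + Q, fun t => by simp [hP, hQ]⟩
  | mul f g _ _ hf hg =>
    obtain ⟨P, hP⟩ := hf
    obtain ⟨Q, hQ⟩ := hg
    exact ⟨P * Q, fun t => by simp [hP, hQ]⟩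

/-- A polynomial function which vanishes on a spanning subgroup is zero. -/
theorem polyFunctions_eq_zero {f : X → ℝ} (hf : f ∈ polyFunctions X) (A : AddSubgroup X)
    (hA : Submodule.span ℝ (A : Set X) = ⊤) (h0 : ∀ x ∈ A, f x = 0) (x : X) : f x = 0 := by
  have key : ∀ w ∈ Submodule.span ℝ (A : Set X), ∀ (t : ℝ) (u : X), (∀ q ∈ A, f (u + q) = 0) →
      ∀ q ∈ A, f (u + t • w + q) = 0 := by
    intro w hw
    induction hw using Submodule.span_induction with
    | mem w hw =>
      intro t u hu q hq
      obtain ⟨P, hP⟩ := exists_polynomial_on_line hf (u + q) w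
      have hP0 : P = 0 := by
        refine P.eq_zero_of_infinite_isRoot (Set.Infinite.mono ?_
          (Set.infinite_range_of_injective (Nat.cast_injective (R := ℝ))))
        rintro _ ⟨n, rfl⟩
        change P.eval (n : ℝ) = 0
        rw [← hP, add_assoc]
        refine hu _ (A.add_mem hq ?_)
        rw [Nat.cast_smul_eq_nsmul]
        exact A.nsmul_mem hw n
      rw [add_right_comm, hP, hP0, Polynomial.eval_zero]
    | zero => intro t u hu; simpa using hu
    | add x y _ _ hx hy =>
      intro t u hu
      rw [smul_add, ← add_assoc]
      exact hy t _ (hx t u hu)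
    | smul c x _ hx =>
      intro t u hu
      rw [smul_smul]
      exact hx _ u hu
  have := key x (hA ▸ Submodule.mem_top) 1 0 (by simpa using h0) 0 A.zero_mem
  simpa using this

end Polynomial

section MainData

variable {V : Type*} [NormedAddCommGroup V] [NormedSpace ℝ V]
  {ℓ : LinearMap.BilinForm ℝ V} {v₀ v₁ : V}

theorem NullPair.nullRot_nullRot (h : NullPair ℓ v₀ v₁) {b c : V} (hb : ℓ v₀ b = 0)
    (hc : ℓ v₀ c = 0) (u : V) :
    nullRot ℓ v₀ b (nullRot ℓ v₀ c u) = nullRot ℓ v₀ (b + c) u := by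
  have hb' : ℓ b v₀ = 0 := (h.symm _ _).trans hb
  simp only [nullRot, map_add, map_sub, map_smul, LinearMap.add_apply, h.iso₀, hc, hb',
    h.symm c b, smul_eq_mul]
  module

/-- The null rotation as a linear automorphism. -/
noncomputable def NullPair.rotEquiv (h : NullPair ℓ v₀ v₁) {b : V} (hb : ℓ v₀ b = 0) : V ≃ₗ[ℝ] V where
  toFun := nullRot ℓ v₀ b
  invFun := nullRot ℓ v₀ (-b)
  map_add' u w := by simp only [nullRot, map_add]; module
  map_smul' c u := by simp only [nullRot, map_smul, smul_eq_mul, RingHom.id_apply]; module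
  left_inv u := by
    rw [h.nullRot_nullRot (by rw [map_neg, hb, neg_zero]) hb]
    simp [nullRot]
  right_inv u := by
    rw [h.nullRot_nullRot hb (by rw [map_neg, hb, neg_zero])]
    simp [nullRot]

/-- The algebraic part of the data of the main construction. -/
structure MainData (ℓ : LinearMap.BilinForm ℝ V) (v₀ v₁ : V) (T : Submodule ℝ V)
    (a : T →ₗ[ℝ] V) : Prop extends NullPair ℓ v₀ v₁ where
  left_T : ∀ x ∈ T, ℓ v₀ x = 0
  right_T : ∀ x ∈ T, ℓ v₁ x = 0
  left_a : ∀ x, ℓ v₀ (a x) = 0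
  right_a : ∀ x, ℓ v₁ (a x) = 0
  a_symm : ∀ x y : T, ℓ (a x) (y : V) = ℓ (x : V) (a y)

namespace MainData

variable {T : Submodule ℝ V} {a : T →ₗ[ℝ] V} (h : MainData ℓ v₀ v₁ T a)
include h

theorem a_left (x : T) : ℓ (a x) v₀ = 0 := (h.symm _ _).trans (h.left_a x)

theorem mainGamma_add (x y : T) (u : V) :
    mainGamma ℓ v₀ a (x + y) u = mainGamma ℓ v₀ a x (mainGamma ℓ v₀ a y u) := by
  have h1 : ℓ (a y) (x : V) = ℓ (a x) (y : V) := by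
    rw [h.a_symm y x, h.symm]
  have h2 : ℓ (a y) (a x) = ℓ (a x) (a y) := h.symm _ _
  have h3 := h.left_T y y.2
  simp only [mainGamma, mainLambda, mainTau, map_add, map_sub, map_smul, LinearMap.add_apply,
    h.iso₀, h.left_a, h.a_left, h1, h2, h3, smul_eq_mul, Submodule.coe_add]
  module

/-- The affine transformation `p + u ↦ p + γ_x(u)`. -/
noncomputable def expAff (p : V) (x : T) : V ≃ᵃ[ℝ] V :=
  AffineEquiv.mk' (fun q => p + mainGamma ℓ v₀ a x (q - p)) (h.rotEquiv (h.left_a x)) p fun q => by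
    change p + (mainLambda ℓ v₀ a x (q - p) + mainTau ℓ v₀ a x) =
      mainLambda ℓ v₀ a x (q - p) + (p + (mainLambda ℓ v₀ a x (p - p) + mainTau ℓ v₀ a x))
    have : mainLambda ℓ v₀ a x (p - p) = 0 := by simp [mainLambda]
    rw [this, zero_add]
    abel

theorem expAff_apply (p : V) (x : T) (q : V) :
    h.expAff p x q = p + mainGamma ℓ v₀ a x (q - p) := rfl

theorem expAff_linear (p : V) (x : T) (u : V) :
    (h.expAff p x).linear u = mainLambda ℓ v₀ a x u := rfl

theorem expAff_apply_add (p : V) (x : T) (u : V) :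
    h.expAff p x (p + u) = p + mainGamma ℓ v₀ a x u := by
  rw [expAff_apply, add_sub_cancel_left]

theorem expAff_add (p : V) (x y : T) : h.expAff p (x + y) = h.expAff p x * h.expAff p y := by
  ext q
  rw [AffineEquiv.mul_apply', expAff_apply, expAff_apply, expAff_apply, add_sub_cancel_left,
    h.mainGamma_add]

theorem expAff_zero (p : V) : h.expAff p 0 = 1 := by
  ext q
  rw [expAff_apply]
  simp [mainGamma, mainLambda, mainTau]

theorem expAff_neg (p : V) (x : T) : h.expAff p (-x) = (h.expAff p x)⁻¹ := by
  rw [eq_inv_iff_mul_eq_one, ← expAff_add, neg_add_cancel, expAff_zero]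

theorem expAff_base (p : V) (x : T) :
    h.expAff p x p = p + ((x : V) - ((1 / 2 : ℝ) * ℓ (a x) (x : V)) • v₀) := by
  have := h.expAff_apply_add p x 0
  rw [add_zero] at this
  rw [this]
  simp [mainGamma, mainLambda, mainTau]

theorem projN_expAff_base (p : V) (x : T) : projN ℓ v₀ v₁ (h.expAff p x p - p) = x := by
  rw [expAff_base, add_sub_cancel_left, map_sub, map_smul, h.projN_left, smul_zero, sub_zero,
    NullPair.projN_eq_self (h.left_T x x.2) (h.right_T x x.2)]

theorem expAff_injective (p : V) : Function.Injective (h.expAff p) := fun x y hxy => by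
  rw [← Subtype.coe_inj, ← h.projN_expAff_base p x, hxy, h.projN_expAff_base]

/-- The coordinates of `expAff p x` are quadratic polynomials. -/
theorem dual_affCoord_expAff [FiniteDimensional ℝ V] (p : V)
    (φ : Module.Dual ℝ ((V →ₗ[ℝ] V) × V)) :
    (fun x => φ (affCoord (h.expAff p x))) ∈ polyFunctions T := by
  let A : T →ₗ[ℝ] (V →ₗ[ℝ] V) × V := LinearMap.prod
    ((LinearMap.smulRightₗ (ℓ v₀)).comp a -
      ((LinearMap.toSpanSingleton ℝ V v₀).compRight ℝ).comp (LinearMap.comp ℓ a))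
    (T.subtype - ℓ v₀ p • a + (LinearMap.toSpanSingleton ℝ V v₀).comp ((ℓ.flip p).comp a))
  let c₁ : (V →ₗ[ℝ] V) × V := (- (1 / 2 : ℝ) • (ℓ v₀).smulRight v₀, ((1 / 2 : ℝ) * ℓ v₀ p) • v₀)
  let c₂ : (V →ₗ[ℝ] V) × V := (0, - (1 / 2 : ℝ) • v₀)
  have key : ∀ x, affCoord (h.expAff p x) =
      (LinearMap.id, 0) + A x + ℓ (a x) (a x) • c₁ + ℓ (a x) (x : V) • c₂ := fun x => by
    refine Prod.ext (LinearMap.ext fun u => ?_) ?_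
    · change mainLambda ℓ v₀ a x u = u + (ℓ v₀ u • a x - ℓ (a x) u • v₀) +
        ℓ (a x) (a x) • (-(1 / 2 : ℝ) • ℓ v₀ u • v₀) + ℓ (a x) (x : V) • (0 : V)
      rw [mainLambda]
      module
    · change p + mainGamma ℓ v₀ a x (0 - p) =
        0 + ((x : V) - ℓ v₀ p • a x + ℓ (a x) p • v₀) +
        ℓ (a x) (a x) • (((1 / 2 : ℝ) * ℓ v₀ p) • v₀) + ℓ (a x) (x : V) • (-(1 / 2 : ℝ) • v₀)
      rw [mainGamma, mainLambda, mainTau, zero_sub, map_neg, map_neg]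
      module
  have h1 : (fun x => φ (affCoord (h.expAff p x))) =
      (fun _ => φ (LinearMap.id, 0)) + (φ.comp A : T → ℝ) +
      (fun x => (ℓ.compl₁₂ a a) x x) * (fun _ => φ c₁) +
      (fun x => (ℓ.compl₁₂ a T.subtype) x x) * (fun _ => φ c₂) := by
    funext x
    rw [key]
    simp
  rw [h1]
  refine add_mem (add_mem (add_mem ?_ ?_) (mul_mem ?_ ?_)) (mul_mem ?_ ?_)
  · exact const_mem_polyFunctions _
  · exact dual_mem_polyFunctions _
  · exact quadratic_mem_polyFunctions _
  · exact const_mem_polyFunctions _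
  · exact quadratic_mem_polyFunctions _
  · exact const_mem_polyFunctions _

omit h in
theorem affCoord_injective : Function.Injective (affCoord : (V ≃ᵃ[ℝ] V) → _) := fun g g' hgg => by
  ext q
  have h1 := g.apply_add 0 q
  have h2 := g'.apply_add 0 q
  rw [zero_add] at h1 h2
  have h3 : g 0 = g' 0 := congrArg Prod.snd hgg
  have h4 : g.linear q = g'.linear q := LinearMap.congr_fun (congrArg Prod.fst hgg) q
  rw [h1, h2, h3, h4]

omit h in
theorem exists_retraction (T : Submodule ℝ V) : ∃ P : V →ₗ[ℝ] T, ∀ x : T, P x = x := by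
  obtain ⟨P, hP⟩ := T.subtype.exists_leftInverse_of_injective T.ker_subtype
  exact ⟨P, fun x => LinearMap.congr_fun hP x⟩

/-- A retraction of `V` to `T` which recovers `x` from the displacement of `p` by `expAff p x`. -/
theorem exists_log : ∃ R : V →ₗ[ℝ] T, (∀ x : T, R x = x) ∧
    ∀ (p : V) (x : T), R (h.expAff p x p - p) = x := by
  obtain ⟨P, hP⟩ := exists_retraction T
  refine ⟨P.comp (projN ℓ v₀ v₁), fun x => ?_, fun p x => ?_⟩
  · rw [LinearMap.comp_apply, NullPair.projN_eq_self (h.left_T x x.2) (h.right_T x x.2), hP]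
  · rw [LinearMap.comp_apply, projN_expAff_base, hP]

theorem zariskiClosure_eq [FiniteDimensional ℝ V] {Γ : Subgroup (V ≃ᵃ[ℝ] V)} (p : V)
    (hΓ : ∀ γ ∈ Γ, ∃ x, γ = h.expAff p x)
    (hspan : Submodule.span ℝ {x : T | h.expAff p x ∈ Γ} = ⊤) :
    zariskiClosure Γ = Set.range (h.expAff p) := by
  obtain ⟨R, -, hR⟩ := h.exists_log
  refine Set.Subset.antisymm (fun g hg => ?_) ?_
  · let Q : (V →ₗ[ℝ] V) × V → T := fun X => R (X.1 p + X.2 - p)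
    have hQ : ∀ g : V ≃ᵃ[ℝ] V, Q (affCoord g) = R (g p - p) := fun g => by
      have := g.apply_add 0 p
      rw [zero_add] at this
      change R (g.linear p + g 0 - p) = _
      rw [this, add_comm (g.linear p)]
    have hQp : ∀ ψ : Module.Dual ℝ T, (fun X => ψ (Q X)) ∈
        polyFunctions ((V →ₗ[ℝ] V) × V) := fun ψ => by
      have : (fun X => ψ (Q X)) = (((ψ.comp R).comp ((LinearMap.applyₗ p).comp
          (LinearMap.fst ℝ (V →ₗ[ℝ] V) V) + LinearMap.snd ℝ (V →ₗ[ℝ] V) V) :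
          Module.Dual ℝ ((V →ₗ[ℝ] V) × V)) : _ → ℝ) + fun _ => -ψ (R p) := by
        funext X
        simp [Q]
        ring
      rw [this]
      exact add_mem (dual_mem_polyFunctions _) (const_mem_polyFunctions _)
    refine ⟨Q (affCoord g), affCoord_injective ?_⟩
    rw [← sub_eq_zero, ← Module.forall_dual_apply_eq_zero_iff ℝ]
    intro φ
    have hf : ((fun X => φ (affCoord (h.expAff p (Q X)))) - (φ : _ → ℝ)) ∈
        polyFunctions ((V →ₗ[ℝ] V) × V) :=
      sub_mem (comp_mem_polyFunctions (h.dual_affCoord_expAff p φ) hQp) (dual_mem_polyFunctions φ)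
    have := hg _ hf fun γ hγ => by
      obtain ⟨x, rfl⟩ := hΓ γ hγ
      simp only [Pi.sub_apply, hQ, hR, sub_self]
    rw [map_sub]
    exact this
  · rintro _ ⟨x, rfl⟩ f hf hf0
    let A : AddSubgroup T :=
      { carrier := {x : T | h.expAff p x ∈ Γ}
        add_mem' := fun {x y} hx hy => by
          change h.expAff p (x + y) ∈ Γ
          rw [expAff_add]; exact Γ.mul_mem hx hy
        zero_mem' := by
          change h.expAff p 0 ∈ Γ
          rw [expAff_zero]; exact Γ.one_mem
        neg_mem' := fun {x} hx => by
          change h.expAff p (-x) ∈ Γ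
          rw [expAff_neg]; exact Γ.inv_mem hx }
    exact polyFunctions_eq_zero (f := fun x => f (affCoord (h.expAff p x)))
      (comp_mem_polyFunctions hf (h.dual_affCoord_expAff p)) A hspan (fun x hx => hf0 _ hx) x

end MainData

end MainData

section Tangent

variable {V : Type*} [NormedAddCommGroup V] [NormedSpace ℝ V]
  {ℓ : LinearMap.BilinForm ℝ V} {v₀ v₁ : V}

theorem hasDerivAt_bilin [FiniteDimensional ℝ V] (ℓ : LinearMap.BilinForm ℝ V) {f g : ℝ → V} {f' g' : V} {t : ℝ}
    (hf : HasDerivAt f f' t) (hg : HasDerivAt g g' t) :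
    HasDerivAt (fun s => ℓ (f s) (g s)) (ℓ (f t) g' + ℓ f' (g t)) t :=
  (LinearMap.toContinuousBilinearMap ℓ).hasDerivAt_of_bilinear (fun _ => hf) (fun _ => hg)

theorem hasDerivAt_linear {E F : Type*} [NormedAddCommGroup E] [NormedSpace ℝ E]
    [FiniteDimensional ℝ E] [NormedAddCommGroup F] [NormedSpace ℝ F] (A : E →ₗ[ℝ] F) {f : ℝ → E}
    {f' : E} {t : ℝ} (hf : HasDerivAt f f' t) : HasDerivAt (fun s => A (f s)) (A f') t :=
  (LinearMap.toContinuousLinearMap A).hasFDerivAt.comp_hasDerivAt t hf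

namespace MainData

variable {T : Submodule ℝ V} {a : T →ₗ[ℝ] V} (h : MainData ℓ v₀ v₁ T a)
include h

theorem expAff_smul_apply (p : V) (x : T) (t : ℝ) (q : V) : h.expAff p (t • x) q =
    p + ((q - p) + t • (ℓ v₀ (q - p) • a x) - (t * ℓ (a x) (q - p)) • v₀
      - (t ^ 2 * ((1 / 2 : ℝ) * ℓ v₀ (q - p) * ℓ (a x) (a x))) • v₀
      + (t • (x : V) - (t ^ 2 * ((1 / 2 : ℝ) * ℓ (a x) (x : V))) • v₀)) := by
  rw [expAff_apply]
  simp only [mainGamma, mainLambda, mainTau, map_smul, LinearMap.smul_apply, smul_eq_mul,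
    Submodule.coe_smul]
  module

theorem continuous_expAff_smul (p : V) (x : T) (q : V) :
    Continuous fun t : ℝ => h.expAff p (t • x) q := by
  simp only [h.expAff_smul_apply]
  fun_prop

theorem expAff_smul_base (p : V) (x : T) (t : ℝ) : h.expAff p (t • x) p =
    p + (t • (x : V) - (t ^ 2 * ((1 / 2 : ℝ) * ℓ (a x) (x : V))) • v₀) := by
  rw [h.expAff_smul_apply]
  simp

theorem hasDerivAt_expAff_smul (p : V) (x : T) :
    HasDerivAt (fun t : ℝ => h.expAff p (t • x) p) (x : V) 0 := by
  simp only [h.expAff_smul_base]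
  have h1 : HasDerivAt (fun t : ℝ => t • (x : V)) ((1 : ℝ) • (x : V)) 0 :=
    (hasDerivAt_id (0 : ℝ)).smul_const _
  have h2 : HasDerivAt (fun t : ℝ => (t ^ 2 * ((1 / 2 : ℝ) * ℓ (a x) (x : V))) • v₀)
      (((2 : ℕ) * (0 : ℝ) ^ 1 * ((1 / 2 : ℝ) * ℓ (a x) (x : V))) • v₀) 0 :=
    ((hasDerivAt_pow 2 (0 : ℝ)).mul_const _).smul_const _
  refine ((h1.sub h2).const_add p).congr_deriv ?_
  simp

variable [FiniteDimensional ℝ V] {Γ : Subgroup (V ≃ᵃ[ℝ] V)} {p : V} (hZ : zariskiClosure Γ = Set.range (h.expAff p))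
include hZ

theorem orbitTangent_eq : orbitTangent Γ p = T := by
  obtain ⟨R, hR, hRp⟩ := h.exists_log
  refine le_antisymm (Submodule.span_le.mpr ?_) fun x hx => Submodule.subset_span ?_
  · rintro _ ⟨c, hc, hc0, hcZ, rfl⟩
    have hd : HasDerivAt c (deriv c 0) 0 :=
      (hc.differentiable (by simp)).differentiableAt.hasDerivAt
    have heq : c = fun t => p + ((R (c t - p) : V) -
        ((1 / 2 : ℝ) * ℓ (a (R (c t - p))) (R (c t - p) : V)) • v₀) := by
      funext t
      obtain ⟨g, hg, hgt⟩ := hcZ t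
      rw [hZ] at hg
      obtain ⟨x, rfl⟩ := hg
      rw [hgt, hRp, h.expAff_base]
    have hdR : HasDerivAt (fun t => R (c t - p)) (R (deriv c 0)) 0 :=
      hasDerivAt_linear R (hd.sub_const p)
    have h1 := hasDerivAt_linear T.subtype hdR
    have h2 := hasDerivAt_bilin ℓ (hasDerivAt_linear a hdR) h1
    have h3 := ((h1.sub ((h2.const_mul (1 / 2 : ℝ)).smul_const v₀))).const_add p
    have h4 := hd.unique
      (h3.congr_of_eventuallyEq (Filter.Eventually.of_forall fun t => congrFun heq t))
    simp only [hc0, sub_self, map_zero, LinearMap.zero_apply, add_zero, mul_zero, zero_smul,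
      sub_zero] at h4
    have h5 : deriv c 0 = (R (deriv c 0) : V) := h4
    rw [SetLike.mem_coe, h5]
    exact (R _).2
  · refine ⟨fun t => h.expAff p (t • ⟨x, hx⟩) p, ?_, ?_, fun t => ⟨_, hZ ▸ ⟨_, rfl⟩, rfl⟩,
      (h.hasDerivAt_expAff_smul p ⟨x, hx⟩).deriv⟩
    · simp only [h.expAff_smul_base]
      fun_prop
    · simp only [zero_smul, h.expAff_zero]
      rfl

theorem isOrbitExp_iff (x : T) (g : V ≃ᵃ[ℝ] V) :
    IsOrbitExp Γ p (x : V) g ↔ g = h.expAff p x := by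
  constructor
  · rintro ⟨f, hadd, hfZ, hcont, hderiv, rfl⟩
    obtain ⟨R, hR, hRp⟩ := h.exists_log
    have hy : ∀ t, f t = h.expAff p (R (f t p - p)) := fun t => by
      have := hfZ t
      rw [hZ] at this
      obtain ⟨y, hy⟩ := this
      rw [← hy, hRp]
    let y : ℝ →+ T := AddMonoidHom.mk' (fun t => R (f t p - p)) fun s t =>
      h.expAff_injective p (by rw [h.expAff_add, ← hy, ← hy, ← hy, hadd])
    have hyc : Continuous y :=
      (LinearMap.continuous_of_finiteDimensional R).comp ((hcont p).sub continuous_const)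
    have hy1 : ∀ t, y t = t • y 1 := fun t => by
      have := map_real_smul y hyc t 1
      rwa [smul_eq_mul, mul_one] at this
    have hd1 : HasDerivAt y (R x) 0 := hasDerivAt_linear R (hderiv.sub_const p)
    have hd2 : HasDerivAt y ((1 : ℝ) • y 1) 0 :=
      ((hasDerivAt_id (0 : ℝ)).smul_const (y 1)).congr_of_eventuallyEq
        (Filter.Eventually.of_forall hy1)
    have hxy := hd1.unique hd2
    rw [hR, one_smul] at hxy
    rw [hy 1, hxy]
    rfl
  · rintro rfl
    refine ⟨fun t => h.expAff p (t • x), fun s t => ?_, fun t => hZ ▸ ⟨_, rfl⟩,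
      h.continuous_expAff_smul p x, h.hasDerivAt_expAff_smul p x, by simp⟩
    simp only [add_smul, h.expAff_add]

end MainData

end Tangent

section LogSpan

variable {V : Type*} [NormedAddCommGroup V] [NormedSpace ℝ V]
  {ℓ : LinearMap.BilinForm ℝ V} {C : Set V} {Γ : Subgroup (V ≃ᵃ[ℝ] V)} {v₀ v₁ : V}

/-- The logarithm of the translation part of `γ` at `p`. -/
noncomputable def logVec (γ : V ≃ᵃ[ℝ] V) (p : V) : V :=
  (γ p - p) + (1 / 2 : ℝ) • ((γ p - p) - γ.linear (γ p - p))

/-- The span of the logarithms of the translation parts of the elements of `Γ`. -/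
def logSpan (Γ : Subgroup (V ≃ᵃ[ℝ] V)) (p : V) : Submodule ℝ V :=
  Submodule.span ℝ {x | ∃ γ ∈ Γ, x = logVec γ p}

theorem logVec_mem_logSpan {γ : V ≃ᵃ[ℝ] V} (hγ : γ ∈ Γ) (p : V) : logVec γ p ∈ logSpan Γ p :=
  Submodule.subset_span ⟨γ, hγ, rfl⟩

namespace HolonomyFrame

variable (h : HolonomyFrame ℓ C Γ v₀ v₁)
include h

theorem logHom_eq (p : V) {γ : V ≃ᵃ[ℝ] V} (hγ : γ ∈ Γ) :
    h.logHom p (Additive.ofMul ⟨γ, hγ⟩) = logVec γ p := by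
  rw [logHom_apply, logVec, h.linear_of_orth hγ (h.left_displacement hγ p)]
  module

theorem left_logSpan (p : V) : ∀ x ∈ logSpan Γ p, ℓ v₀ x = 0 := by
  intro x hx
  induction hx using Submodule.span_induction with
  | mem x hx =>
    obtain ⟨γ, hγ, rfl⟩ := hx
    rw [← h.logHom_eq p hγ, h.left_logHom]
  | zero => simp
  | add x y _ _ hx hy => simp [hx, hy]
  | smul c x _ hx => simp [hx]

variable [FiniteDimensional ℝ V]

theorem notMem_logSpan (p : V) : v₀ ∉ logSpan Γ p := by
  intro hv
  obtain ⟨a, ha⟩ := exists_linear_of_discrete (h.stepHom p 0) (h.logHom p)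
    (h.stepHom_injective p 0) (h.stepHom_discrete p 0)
  have key : ∀ x ∈ logSpan Γ p, a (projN ℓ v₀ v₁ x) = x := by
    intro x hx
    induction hx using Submodule.span_induction with
    | mem x hx =>
      obtain ⟨γ, hγ, rfl⟩ := hx
      have := ha (Additive.ofMul ⟨γ, hγ⟩)
      rwa [stepHom_eq, zero_smul, add_zero, h.logHom_eq p hγ] at this
    | zero => simp
    | add x y _ _ hx hy => simp [hx, hy]
    | smul c x _ hx => simp [hx]
  have := key v₀ hv
  rw [h.projN_left, map_zero] at this
  exact h.ne_zero this.symm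

theorem exists_perp_logSpan (p : V) :
    ∃ v₁, ℓ v₁ v₁ = 0 ∧ ℓ v₀ v₁ = 1 ∧ ∀ x ∈ logSpan Γ p, ℓ v₁ x = 0 :=
  h.lorentzian.exists_isotropic h.iso₀ (logSpan Γ p) (h.left_logSpan p) (h.notMem_logSpan p)

/-- In a null frame orthogonal to the logarithms, `Γ` is a lattice in the group of the main
construction. -/
theorem exists_mainData (p : V) (hperp : ∀ x ∈ logSpan Γ p, ℓ v₁ x = 0) (T : Submodule ℝ V)
    (hT : T = logSpan Γ p) : ∃ (a : T →ₗ[ℝ] V) (hD : MainData ℓ v₀ v₁ T a),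
      (∀ γ ∈ Γ, ∃ x, γ = hD.expAff p x) ∧
      Submodule.span ℝ {x : T | hD.expAff p x ∈ Γ} = ⊤ ∧
      (∀ (s : ℝ) (x : T), (x : V) + s • a x = 0 → x = 0) ∧
      ∃ ε > 0, ∀ x : T, hD.expAff p x ∈ Γ → ‖(x : V)‖ < ε → x = 0 := by
  have hstep : ∀ (s : ℝ) γ (hγ : γ ∈ Γ), h.stepHom p s (Additive.ofMul ⟨γ, hγ⟩) =
      logVec γ p + s • rotPart ℓ v₀ v₁ γ := fun s γ hγ => by
    have hmem := logVec_mem_logSpan hγ p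
    rw [stepHom_eq, h.logHom_eq p hγ, NullPair.projN_eq_self (h.left_logSpan p _ hmem)
      (hperp _ hmem), rotHom_apply]
  obtain ⟨A, hA⟩ := exists_linear_of_discrete (h.stepHom p 0) h.rotHom
    (h.stepHom_injective p 0) (h.stepHom_discrete p 0)
  have hA' : ∀ γ ∈ Γ, A (logVec γ p) = rotPart ℓ v₀ v₁ γ := fun γ hγ => by
    have := hA (Additive.ofMul ⟨γ, hγ⟩)
    rwa [hstep, zero_smul, add_zero, rotHom_apply] at this
  have hA0 : ∀ x ∈ logSpan Γ p, ℓ v₀ (A x) = 0 ∧ ℓ v₁ (A x) = 0 := by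
    intro x hx
    induction hx using Submodule.span_induction with
    | mem x hx =>
      obtain ⟨γ, hγ, rfl⟩ := hx
      rw [hA' γ hγ]
      exact ⟨h.left_rotPart γ, h.right_rotPart γ⟩
    | zero => simp
    | add x y _ _ hx hy => simp [hx, hy]
    | smul c x _ hx => simp [hx]
  have hrot : ∀ γ ∈ Γ, ∀ δ ∈ Γ, ℓ (rotPart ℓ v₀ v₁ γ) (logVec δ p) =
      ℓ (rotPart ℓ v₀ v₁ γ) (δ p - p) := fun γ _ δ hδ => by
    rw [← h.logHom_eq p hδ, logHom_apply, map_add, map_smul, h.rotPart_left, smul_zero, add_zero]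
  have hAs : ∀ x ∈ logSpan Γ p, ∀ y ∈ logSpan Γ p, ℓ (A x) y = ℓ x (A y) := by
    intro x hx y hy
    induction hx, hy using Submodule.span_induction₂ with
    | mem_mem x y hx hy =>
      obtain ⟨γ, hγ, rfl⟩ := hx
      obtain ⟨δ, hδ, rfl⟩ := hy
      rw [h.symm _ (A _), hA' γ hγ, hA' δ hδ, hrot γ hγ δ hδ, hrot δ hδ γ hγ, h.rotPart_symm hγ hδ]
    | zero_left => simp
    | zero_right => simp
    | add_left x y z _ _ _ hx hy => simp [hx, hy]
    | add_right x y z _ _ _ hx hy => simp [hx, hy]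
    | smul_left c x y _ _ hx => simp [hx]
    | smul_right c x y _ _ hx => simp [hx]
  have hAfree : ∀ (s : ℝ), ∀ x ∈ logSpan Γ p, x + s • A x = 0 → x = 0 := by
    intro s x hx hx0
    obtain ⟨B, hB⟩ := exists_linear_of_discrete (h.stepHom p s) (h.logHom p)
      (h.stepHom_injective p s) (h.stepHom_discrete p s)
    have key : ∀ x ∈ logSpan Γ p, B (x + s • A x) = x := by
      intro x hx
      induction hx using Submodule.span_induction with
      | mem x hx =>
        obtain ⟨γ, hγ, rfl⟩ := hx
        have := hB (Additive.ofMul ⟨γ, hγ⟩)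
        rwa [hstep, h.logHom_eq p hγ, ← hA' γ hγ] at this
      | zero => simp
      | add x y _ _ hx hy =>
        rw [map_add A, smul_add, add_add_add_comm, map_add, hx, hy]
      | smul c x _ hx =>
        rw [map_smul A, smul_comm, ← smul_add, map_smul, hx]
    rw [← key x hx, hx0, map_zero]
  have hD : MainData ℓ v₀ v₁ T (A.domRestrict T) :=
    { toNullPair := h.toNullPair
      left_T := hT ▸ h.left_logSpan p
      right_T := hT ▸ hperp
      left_a := fun x => (hA0 x (hT ▸ x.2)).1
      right_a := fun x => (hA0 x (hT ▸ x.2)).2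
      a_symm := fun x y => hAs x (hT ▸ x.2) y (hT ▸ y.2) }
  have hexp : ∀ γ ∈ Γ, ∀ hx : logVec γ p ∈ T, γ = hD.expAff p ⟨logVec γ p, hx⟩ := by
    intro γ hγ hx
    ext q
    have hb : A (logVec γ p) = rotPart ℓ v₀ v₁ γ := hA' γ hγ
    have h1 := γ.apply_add p (q - p)
    rw [add_sub_cancel] at h1
    rw [hD.expAff_apply, h1, h.linear hγ]
    change γ p + nullRot ℓ v₀ (rotPart ℓ v₀ v₁ γ) (q - p) =
      p + (nullRot ℓ v₀ (A (logVec γ p)) (q - p) +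
        (logVec γ p - ((1 / 2 : ℝ) * ℓ (A (logVec γ p)) (logVec γ p)) • v₀))
    rw [hb, hrot γ hγ γ hγ, ← h.logHom_eq p hγ, logHom_apply]
    abel
  have hmem : ∀ γ ∈ Γ, logVec γ p ∈ T := fun γ hγ => hT ▸ logVec_mem_logSpan hγ p
  have hlog : ∀ x : T, hD.expAff p x ∈ Γ → logVec (hD.expAff p x) p = x := fun x hx =>
    congrArg Subtype.val (hD.expAff_injective p (hexp _ hx (hmem _ hx)).symm)
  refine ⟨A.domRestrict T, hD, fun γ hγ => ⟨_, hexp γ hγ (hmem γ hγ)⟩, ?_,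
    fun s x hx => Subtype.ext (hAfree s x (hT ▸ x.2) hx), ?_⟩
  · refine Submodule.map_injective_of_injective T.injective_subtype ?_
    rw [Submodule.map_span, Submodule.map_top, Submodule.range_subtype]
    refine le_antisymm (Submodule.span_le.mpr ?_) ?_
    · rintro _ ⟨x, -, rfl⟩
      exact x.2
    · conv_lhs => rw [hT]
      refine Submodule.span_mono ?_
      rintro _ ⟨γ, hγ, rfl⟩
      refine ⟨⟨logVec γ p, hmem γ hγ⟩, ?_, rfl⟩
      change hD.expAff p _ ∈ Γ
      rwa [← hexp γ hγ]
  · obtain ⟨ε, hε, hd⟩ := h.stepHom_discrete p 0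
    refine ⟨ε, hε, fun x hx hxε => Subtype.ext ?_⟩
    have := hd (Additive.ofMul ⟨_, hx⟩)
    rw [hstep, zero_smul, add_zero, hlog x hx] at this
    exact this hxε

theorem orbitTangent_eq_logSpan (p : V) (hperp : ∀ x ∈ logSpan Γ p, ℓ v₁ x = 0) :
    orbitTangent Γ p = logSpan Γ p := by
  obtain ⟨a, hD, h1, h2, -⟩ := h.exists_mainData p hperp _ rfl
  exact hD.orbitTangent_eq (hD.zariskiClosure_eq p h1 h2)

end HolonomyFrame

end LogSpan

section Quotient

variable {V : Type*} [NormedAddCommGroup V] [NormedSpace ℝ V]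
  {ℓ : LinearMap.BilinForm ℝ V} {C : Set V} {Γ : Subgroup (V ≃ᵃ[ℝ] V)}

theorem IsStrictlyCausal.isCoveringMap_kappa [FiniteDimensional ℝ V]
    (h : IsStrictlyCausal ℓ C Γ) :
    IsCoveringMap (kappa Γ) ∧ IsOpenQuotientMap (kappa Γ) := by
  let _ : MulAction Γ V :=
    { smul := fun γ u => γ.1 u
      one_smul := fun _ => rfl
      mul_smul := fun _ _ _ => rfl }
  have : ContinuousConstSMul Γ V :=
    ⟨fun γ => AffineEquiv.continuous_of_finiteDimensional γ.1⟩
  have : ProperlyDiscontinuousSMul Γ V := ⟨fun {K L} hK hL => by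
    refine ((h.proper (K ∪ L) (hK.union hL)).preimage
      (Set.injOn_of_injective (Subtype.val_injective (p := (· ∈ Γ))))).subset ?_
    rintro γ ⟨x, ⟨k, hk, rfl⟩, hx⟩
    exact ⟨γ.2, γ.1 k, ⟨k, Or.inl hk, rfl⟩, Or.inr hx⟩⟩
  have : IsCancelSMul Γ V := isCancelSMul_iff_eq_one_of_smul_eq.mpr fun γ u hu =>
    Subtype.ext (h.free γ.1 γ.2 u hu)
  have hq : IsQuotientCoveringMap (kappa Γ) Γ :=
    Topology.IsQuotientMap.isQuotientCoveringMap_of_properlyDiscontinuousSMul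
      (isQuotientMap_quotient_mk' (s := orbitSetoid Γ)) fun {u w} => by
        rw [eq_comm]
        refine kappa_eq_iff.trans ⟨?_, ?_⟩
        · rintro ⟨γ, hγ, rfl⟩
          exact ⟨⟨γ, hγ⟩, rfl⟩
        · rintro ⟨γ, rfl⟩
          exact ⟨γ.1, γ.2, rfl⟩
  exact ⟨hq.isCoveringMap, hq.isOpenQuotientMap⟩

theorem IsStrictlyCausal.isCoveringMap_expAt [FiniteDimensional ℝ V]
    (h : IsStrictlyCausal ℓ C Γ) (v : V) :
    IsCoveringMap (expAt Γ v) :=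
  h.isCoveringMap_kappa.1.comp_homeomorph (Homeomorph.addLeft v)

theorem continuous_expAt (Γ : Subgroup (V ≃ᵃ[ℝ] V)) (v : V) : Continuous (expAt Γ v) :=
  (continuous_kappa Γ).comp (continuous_const.add continuous_id)

theorem expAt_surjective (Γ : Subgroup (V ≃ᵃ[ℝ] V)) (v : V) :
    Function.Surjective (expAt Γ v) := fun q => by
  obtain ⟨u, rfl⟩ := Quotient.exists_rep q
  refine ⟨u - v, ?_⟩
  change kappa Γ (v + (u - v)) = kappa Γ u
  rw [add_sub_cancel]

/-- `Γ` keeps `v + F` invariant, and its linear parts fix the complement `E` of `F` pointwise. -/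
structure ProductSplitting (Γ : Subgroup (V ≃ᵃ[ℝ] V)) (v : V) (E F : Submodule ℝ V) : Prop where
  isCompl : IsCompl E F
  map_mem : ∀ γ ∈ Γ, ∀ w ∈ F, γ (v + w) - v ∈ F
  fixed : ∀ γ ∈ Γ, ∀ x ∈ E, γ.linear x = x

namespace ProductSplitting

variable {v : V} {E F : Submodule ℝ V} (h : ProductSplitting Γ v E F)
include h

theorem linear_mem {γ : V ≃ᵃ[ℝ] V} (hγ : γ ∈ Γ) {w : V} (hw : w ∈ F) : γ.linear w ∈ F := by
  have h1 := F.sub_mem (h.map_mem γ hγ w hw) (h.map_mem γ hγ 0 F.zero_mem)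
  rw [γ.apply_add, add_zero] at h1
  convert h1 using 1
  abel

/-- The restriction to `v + F` of an element of `Γ`. -/
theorem exists_restrict {γ : V ≃ᵃ[ℝ] V} (hγ : γ ∈ Γ) :
    ∃ δ ∈ restrictGroup Γ v F, (∀ w : F, γ (v + w) = v + (δ w : V)) ∧
      ∀ w : F, (δ.linear w : V) = γ.linear w := by
  let A : F ≃ₗ[ℝ] F := LinearEquiv.ofLinearMap
    ((γ.linear : V →ₗ[ℝ] V).restrict fun w hw => h.linear_mem hγ hw)
    (((γ⁻¹).linear : V →ₗ[ℝ] V).restrict fun w hw => h.linear_mem (Γ.inv_mem hγ) hw)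
    (LinearMap.ext fun w => Subtype.ext (γ.linear.apply_symm_apply (w : V)))
    (LinearMap.ext fun w => Subtype.ext (γ.linear.symm_apply_apply (w : V)))
  let δ : F ≃ᵃ[ℝ] F := AffineEquiv.mk' (fun w => ⟨γ (v + w) - v, h.map_mem γ hγ w w.2⟩) A 0
    fun w => Subtype.ext (by
      change γ (v + w) - v = γ.linear ((w : V) - (0 : V)) + (γ (v + (0 : V)) - v)
      rw [γ.apply_add, sub_zero, add_zero]
      abel)
  have hδ : ∀ w : F, γ (v + w) = v + (δ w : V) := fun w => by
    change γ (v + w) = v + (γ (v + w) - v)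
    rw [add_sub_cancel]
  exact ⟨δ, ⟨γ, hγ, hδ⟩, hδ, fun w => rfl⟩

omit h in
theorem linear_eq {γ : V ≃ᵃ[ℝ] V} {δ : F ≃ᵃ[ℝ] F} (hδ : ∀ w : F, γ (v + w) = v + (δ w : V))
    (w : F) : (δ.linear w : V) = γ.linear w := by
  have h1 := hδ w
  have h2 := hδ 0
  have h3 := congrArg Subtype.val (δ.apply_add 0 w)
  rw [γ.apply_add] at h1 h2
  rw [Submodule.coe_zero, map_zero, add_zero] at h2
  rw [zero_add, Submodule.coe_add] at h3
  rw [h2, h3, ← add_assoc] at h1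
  exact (add_left_cancel h1).symm

theorem kappa_eq_iff {w w' : F} :
    kappa (restrictGroup Γ v F) w = kappa (restrictGroup Γ v F) w' ↔
      expAt Γ v (w : V) = expAt Γ v (w' : V) := by
  rw [_root_.kappa_eq_iff, expAt, expAt, _root_.kappa_eq_iff]
  constructor
  · rintro ⟨δ, ⟨γ, hγ, hδ⟩, rfl⟩
    exact ⟨γ, hγ, hδ w⟩
  · rintro ⟨γ, hγ, hw⟩
    obtain ⟨δ, hδ, hδγ, -⟩ := h.exists_restrict hγ
    refine ⟨δ, hδ, Subtype.ext ?_⟩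
    rw [hδγ] at hw
    exact add_left_cancel hw

/-- The embedding of the quotient of `F` induced by the exponential map. -/
noncomputable def embed : FlatQuotient (restrictGroup Γ v F) → FlatQuotient Γ :=
  Quotient.lift (fun w : F => expAt Γ v (w : V)) fun _ _ hw =>
    h.kappa_eq_iff.mp (Quotient.sound hw)

theorem embed_kappa (w : F) : h.embed (kappa (restrictGroup Γ v F) w) = expAt Γ v (w : V) := rfl

theorem continuous_embed : Continuous h.embed :=
  Continuous.quotient_lift ((continuous_expAt Γ v).comp continuous_subtype_val) _

theorem exists_decomp (q : V) : ∃ (x : E) (w : F), q = v + ((x : V) + w) := by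
  obtain ⟨x, hx, w, hw, hq⟩ := Submodule.mem_sup.mp
    (h.isCompl.sup_eq_top ▸ Submodule.mem_top : q - v ∈ E ⊔ F)
  exact ⟨⟨x, hx⟩, ⟨w, hw⟩, by rw [hq, add_sub_cancel]⟩

theorem projE_apply (x : E) (w : F) : E.projectionOnto F h.isCompl (v + ((x : V) + w) - v) = x := by
  rw [add_sub_cancel_left, map_add, Submodule.projectionOnto_apply_left,
    Submodule.projectionOnto_apply_right, add_zero]

theorem projF_apply (x : E) (w : F) :
    F.projectionOnto E h.isCompl.symm (v + ((x : V) + w) - v) = w := by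
  rw [add_sub_cancel_left, map_add, Submodule.projectionOnto_apply_left,
    Submodule.projectionOnto_apply_right, zero_add]

theorem apply_decomp {γ : V ≃ᵃ[ℝ] V} (hγ : γ ∈ Γ) {δ : F ≃ᵃ[ℝ] F}
    (hδ : ∀ w : F, γ (v + w) = v + (δ w : V)) (x : E) (w : F) :
    γ (v + ((x : V) + w)) = v + ((x : V) + δ w) := by
  rw [add_comm (x : V), ← add_assoc, γ.apply_add, hδ, h.fixed γ hγ x x.2]
  abel

/-- The retraction of the quotient of `V` to the quotient of `F`. -/
noncomputable def retract : FlatQuotient Γ → FlatQuotient (restrictGroup Γ v F) :=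
  Quotient.lift (fun q => kappa (restrictGroup Γ v F)
      (F.projectionOnto E h.isCompl.symm (q - v))) fun q q' hq => by
    obtain ⟨γ, hγ, rfl⟩ := hq
    obtain ⟨δ, hδ, hδγ, -⟩ := h.exists_restrict hγ
    obtain ⟨x, w, rfl⟩ := h.exists_decomp q
    refine _root_.kappa_eq_iff.mpr ⟨δ, hδ, ?_⟩
    rw [h.apply_decomp hγ hδγ, h.projF_apply, h.projF_apply]

/-- The component in `E` of the points of the quotient of `V`. -/
noncomputable def proj : FlatQuotient Γ → E :=
  Quotient.lift (fun q => E.projectionOnto F h.isCompl (q - v)) fun q q' hq => by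
    obtain ⟨γ, hγ, rfl⟩ := hq
    obtain ⟨δ, hδ, hδγ, -⟩ := h.exists_restrict hγ
    obtain ⟨x, w, rfl⟩ := h.exists_decomp q
    change E.projectionOnto F h.isCompl _ = E.projectionOnto F h.isCompl _
    rw [h.apply_decomp hγ hδγ, h.projE_apply, h.projE_apply]

theorem retract_expAt (x : E) (w : F) :
    h.retract (expAt Γ v ((x : V) + w)) = kappa (restrictGroup Γ v F) w :=
  congrArg (kappa (restrictGroup Γ v F)) (h.projF_apply x w)

theorem proj_expAt (x : E) (w : F) : h.proj (expAt Γ v ((x : V) + w)) = x := h.projE_apply x w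

/-- The action of `E` on the quotient of `V` by translations. -/
noncomputable def translate (x : E) : FlatQuotient Γ → FlatQuotient Γ :=
  Quotient.lift (fun q => kappa Γ (q + x)) fun q q' hq => by
    obtain ⟨γ, hγ, rfl⟩ := hq
    refine _root_.kappa_eq_iff.mpr ⟨γ, hγ, ?_⟩
    rw [γ.apply_add, h.fixed γ hγ x x.2]

theorem translate_expAt (x : E) (w : V) :
    h.translate x (expAt Γ v w) = expAt Γ v ((x : V) + w) := by
  change kappa Γ (v + w + x) = kappa Γ (v + (x + w))
  rw [add_comm (x : V), add_assoc]

theorem continuous_translate (hk : IsOpenQuotientMap (kappa Γ)) :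
    Continuous fun q : E × FlatQuotient Γ => h.translate q.1 q.2 := by
  rw [← (IsOpenQuotientMap.id.prodMap hk).continuous_comp_iff]
  exact (continuous_kappa Γ).comp
    (continuous_snd.add (continuous_subtype_val.comp continuous_fst))

theorem range_embed : Set.range h.embed = expAt Γ v '' (F : Set V) := by
  ext q
  constructor
  · rintro ⟨q, rfl⟩
    obtain ⟨w, rfl⟩ := Quotient.exists_rep q
    exact ⟨w, w.2, rfl⟩
  · rintro ⟨w, hw, rfl⟩
    exact ⟨kappa _ ⟨w, hw⟩, rfl⟩

theorem closedNear_of_embed {A : Set (FlatQuotient Γ)} {w : F}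
    (hA : ClosedNear A (kappa Γ (v + w))) :
    ClosedNear (h.embed ⁻¹' A) (kappa (restrictGroup Γ v F) w) := by
  obtain ⟨U, hU, hcl⟩ := hA
  refine ⟨h.embed ⁻¹' U, h.continuous_embed.continuousAt.preimage_mem_nhds hU, ?_⟩
  have hc : Continuous fun q : (h.embed ⁻¹' U : Set _) => (⟨h.embed q, q.2⟩ : U) :=
    (h.continuous_embed.comp continuous_subtype_val).subtype_mk _
  exact hcl.preimage hc

variable [FiniteDimensional ℝ V]

theorem continuous_retract : Continuous h.retract :=
  Continuous.quotient_lift ((continuous_kappa _).comp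
    ((LinearMap.continuous_of_finiteDimensional _).comp (continuous_id.sub continuous_const))) _

theorem continuous_proj : Continuous h.proj :=
  Continuous.quotient_lift
    ((LinearMap.continuous_of_finiteDimensional _).comp (continuous_id.sub continuous_const)) _

theorem isEmbedding_embed : IsEmbedding h.embed := by
  refine Function.LeftInverse.isEmbedding (f := h.retract) (fun q => ?_) h.continuous_retract
    h.continuous_embed
  obtain ⟨w, rfl⟩ := Quotient.exists_rep q
  have := h.retract_expAt 0 w
  rw [Submodule.coe_zero, zero_add] at this
  exact this

/-- The product decomposition of the quotient of `V`. -/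
theorem exists_homeomorph (hk : IsOpenQuotientMap (kappa Γ)) :
    ∃ Φ : E × (expAt Γ v '' (F : Set V)) ≃ₜ FlatQuotient Γ,
      ∀ (x : E) (w : F), Φ (x, ⟨expAt Γ v (w : V), (w : V), w.2, rfl⟩) =
        expAt Γ v ((x : V) + (w : V)) := by
  have hmem : ∀ q, h.embed (h.retract q) ∈ expAt Γ v '' (F : Set V) := fun q =>
    h.range_embed ▸ ⟨_, rfl⟩
  refine ⟨{ toFun := fun q => h.translate q.1 q.2
            invFun := fun q => (h.proj q, ⟨h.embed (h.retract q), hmem q⟩)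
            left_inv := ?_
            right_inv := ?_
            continuous_toFun := (h.continuous_translate hk).comp
              (continuous_fst.prodMk (continuous_subtype_val.comp continuous_snd))
            continuous_invFun := h.continuous_proj.prodMk
              ((h.continuous_embed.comp h.continuous_retract).subtype_mk _) },
    fun x w => h.translate_expAt x w⟩
  · rintro ⟨x, _, w, hw, rfl⟩
    have h1 := h.translate_expAt x w
    refine Prod.ext ?_ (Subtype.ext ?_)
    · change h.proj (h.translate x (expAt Γ v w)) = x
      rw [h1]
      exact h.proj_expAt x ⟨w, hw⟩
    · change h.embed (h.retract (h.translate x (expAt Γ v w))) = expAt Γ v w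
      rw [h1]
      exact congrArg h.embed (h.retract_expAt x ⟨w, hw⟩)
  · intro q
    obtain ⟨u, rfl⟩ := Quotient.exists_rep q
    obtain ⟨x, w, rfl⟩ := h.exists_decomp u
    change h.translate (h.proj (expAt Γ v (x + w))) (h.embed (h.retract (expAt Γ v (x + w)))) =
      expAt Γ v (x + w)
    rw [h.proj_expAt, h.retract_expAt, h.embed_kappa, h.translate_expAt]

omit [FiniteDimensional ℝ V] in
theorem isStrictlyCausal (hM : IsStrictlyCausal ℓ C Γ) {f : V} (hf : f ∈ F) (hpos : 0 < ℓ f f) :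
    IsStrictlyCausal (ℓ.restrict F) ((Subtype.val : F → V) ⁻¹' C) (restrictGroup Γ v F) := by
  have hcone : ∀ δ ∈ restrictGroup Γ v F, ∀ w : F, (w : V) ∈ C → (δ.linear w : V) ∈ C := by
    rintro δ ⟨γ, hγ, hδ⟩ w hw
    rw [linear_eq hδ, ← hM.map_cone γ hγ]
    exact ⟨w, hw, rfl⟩
  have hext : ∀ δ ∈ restrictGroup Γ v F, ∀ δ' : F ≃ᵃ[ℝ] F, ∀ γ : V ≃ᵃ[ℝ] V,
      (∀ w : F, γ (v + w) = v + (δ w : V)) → (∀ w : F, γ (v + w) = v + (δ' w : V)) →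
      δ = δ' := by
    intro δ _ δ' γ hδ hδ'
    ext w
    exact add_left_cancel ((hδ w).symm.trans (hδ' w))
  have hone : ∀ w : F, (1 : V ≃ᵃ[ℝ] V) (v + w) = v + ((1 : F ≃ᵃ[ℝ] F) w : V) := fun _ => rfl
  refine ⟨hM.lorentzian.restrict hf hpos, ?_, ?_, fun δ hδ => ?_, ?_, fun K hK => ?_, ?_,
    fun w => ?_, fun w => ?_⟩
  · obtain ⟨e, he, hC⟩ := hM.cone
    obtain ⟨f', hf', hpos', hef⟩ : ∃ f' ∈ F, 0 < ℓ f' f' ∧ 0 ≤ ℓ e f' := by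
      rcases le_total 0 (ℓ e f) with h0 | h0
      · exact ⟨f, hf, hpos, h0⟩
      · exact ⟨-f, F.neg_mem hf, by simpa using hpos, by simpa using h0⟩
    refine ⟨⟨f', hf'⟩, hpos', ?_⟩
    rw [hC, show {w | 0 ≤ ℓ w w ∧ 0 ≤ ℓ e w} = timeCone ℓ e from rfl,
      hM.lorentzian.timeCone_eq he hpos' hef]
    rfl
  · rintro δ ⟨γ, hγ, hδ⟩ u w
    change ℓ (δ.linear u : V) (δ.linear w : V) = ℓ (u : V) (w : V)
    rw [linear_eq hδ, linear_eq hδ, hM.isometric γ hγ]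
  · refine Set.Subset.antisymm ?_ fun w hw => ?_
    · rintro _ ⟨w, hw, rfl⟩
      exact hcone δ hδ w hw
    · exact ⟨(δ⁻¹).linear w, hcone δ⁻¹ ((restrictGroup Γ v F).inv_mem hδ) w hw,
        δ.linear.apply_symm_apply w⟩
  · rintro δ ⟨γ, hγ, hδ⟩ w hw
    have h1 : γ (v + w) = v + w := by rw [hδ, hw]
    have := hM.free γ hγ _ h1
    subst this
    exact hext δ ⟨1, hγ, hδ⟩ 1 1 hδ hone
  · have hKc : IsCompact ((fun w : F => v + (w : V)) '' K) :=
      hK.image (continuous_const.add continuous_subtype_val)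
    have hfin := hM.proper _ hKc
    choose! g hg hgw using fun δ (hδ : δ ∈ restrictGroup Γ v F) => hδ
    refine Set.Finite.of_finite_image (f := g) (hfin.subset ?_) ?_
    · rintro _ ⟨δ, ⟨hδ, _, ⟨w, hw, rfl⟩, hw'⟩, rfl⟩
      exact ⟨hg δ hδ, v + (δ w : V), ⟨v + w, ⟨w, hw, rfl⟩, hgw δ hδ w⟩, ⟨δ w, hw', rfl⟩⟩
    · rintro δ ⟨hδ, -⟩ δ' ⟨hδ', -⟩ hgg
      exact hext δ hδ δ' (g δ) (hgw δ hδ) (hgg ▸ hgw δ' hδ')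
  · rintro δ ⟨γ, hγ, hδ⟩ hne w hw
    refine hM.causal γ hγ (fun h1 => ?_) (v + w) ?_
    · subst h1
      exact hne (hext δ ⟨1, hγ, hδ⟩ 1 1 hδ hone)
    · rw [hδ, add_sub_add_left_eq_sub]
      exact hw
  · convert h.closedNear_of_embed (hM.closed_future (v + w)) using 1
    ext q
    obtain ⟨w', rfl⟩ := Quotient.exists_rep q
    constructor
    · rintro ⟨c, hc, hq⟩
      refine ⟨c, hc, ?_⟩
      have := h.kappa_eq_iff.mp hq
      rw [expAt, expAt, Submodule.coe_add, ← add_assoc] at this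
      exact this
    · rintro ⟨c, hc, hq⟩
      obtain ⟨γ, hγ, hγw⟩ := (_root_.kappa_eq_iff (u := v + (w' : V))).mp hq
      have hcF : c ∈ F := by
        have := F.sub_mem (h.map_mem γ hγ w' w'.2) w.2
        rwa [hγw, show v + (w : V) + c - v - w = c by abel] at this
      refine ⟨⟨c, hcF⟩, hc, h.kappa_eq_iff.mpr ?_⟩
      rw [expAt, expAt, Submodule.coe_add, ← add_assoc]
      exact hq
  · convert h.closedNear_of_embed (hM.closed_past (v + w)) using 1
    ext q
    obtain ⟨w', rfl⟩ := Quotient.exists_rep q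
    constructor
    · rintro ⟨c, hc, hq⟩
      refine ⟨c, hc, ?_⟩
      have := h.kappa_eq_iff.mp hq
      rw [expAt, expAt, Submodule.coe_sub, ← add_sub_assoc] at this
      exact this
    · rintro ⟨c, hc, hq⟩
      obtain ⟨γ, hγ, hγw⟩ := (_root_.kappa_eq_iff (u := v + (w' : V))).mp hq
      have hcF : c ∈ F := by
        have := F.sub_mem w.2 (h.map_mem γ hγ w' w'.2)
        rwa [hγw, show (w : V) - (v + (w : V) - c - v) = c by abel] at this
      refine ⟨⟨c, hcF⟩, hc, h.kappa_eq_iff.mpr ?_⟩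
      rw [expAt, expAt, Submodule.coe_sub, ← add_sub_assoc]
      exact hq

end ProductSplitting

/-- A group of affine transformations has unipotent linear parts if they have a common fixed vector
in each nonzero quotient. -/
theorem hasUnipotentHolonomy_of_fixed_mod [FiniteDimensional ℝ V]
    (h : ∀ Y : Submodule ℝ V, Y ≠ ⊤ → ∃ x, x ∉ Y ∧ ∀ γ ∈ Γ, γ.linear x - x ∈ Y) :
    HasUnipotentHolonomy Γ := by
  classical
  have key : ∀ n ≤ Module.finrank ℝ V, ∃ b : Fin n → V, LinearIndependent ℝ b ∧
      ∀ γ ∈ Γ, ∀ i, γ.linear (b i) - b i ∈ Submodule.span ℝ (b '' {j | j < i}) := by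
    intro n
    induction n with
    | zero => exact fun _ => ⟨Fin.elim0, linearIndependent_empty_type, fun _ _ i => i.elim0⟩
    | succ n ih =>
      intro hn
      obtain ⟨b, hb, hbγ⟩ := ih (by omega)
      obtain ⟨x, hx, hxγ⟩ := h (Submodule.span ℝ (Set.range b)) fun htop => by
        have := finrank_span_eq_card hb
        rw [htop, finrank_top, Fintype.card_fin] at this
        omega
      refine ⟨Fin.snoc b x, linearIndependent_finSnoc.mpr ⟨hb, hx⟩, fun γ hγ i => ?_⟩
      induction i using Fin.lastCases with
      | last =>
        rw [Fin.snoc_last]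
        refine Submodule.span_mono ?_ (hxγ γ hγ)
        rintro _ ⟨j, rfl⟩
        exact ⟨j.castSucc, Fin.castSucc_lt_last j, Fin.snoc_castSucc ..⟩
      | cast i =>
        rw [Fin.snoc_castSucc]
        refine Submodule.span_mono ?_ (hbγ γ hγ i)
        rintro _ ⟨j, hj, rfl⟩
        exact ⟨j.castSucc, Fin.castSucc_lt_castSucc_iff.mpr hj, Fin.snoc_castSucc ..⟩
  obtain ⟨b, hb, hbγ⟩ := key _ le_rfl
  let B := basisOfLinearIndependentOfCardEqFinrank' b hb (by simp)
  have hB : ∀ i, B i = b i := fun i => by simp [B]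
  have hz : ∀ γ ∈ Γ, ∀ i j, j ≤ i → B.repr (γ.linear (B j) - B j) i = 0 := fun γ hγ i j hji => by
    have h1 : γ.linear (B j) - B j ∈ Submodule.span ℝ (B '' {k | k < j}) := by
      have h2 := hbγ γ hγ j
      rwa [show (B : _ → V) = b from funext hB]
    by_contra hne
    have h3 : i < j := B.repr_support_subset_of_mem_span _ h1 (Finsupp.mem_support_iff.mpr hne)
    exact absurd h3 (not_lt.mpr hji)
  refine ⟨B, fun γ hγ => ⟨fun i j hji => ?_, fun i => ?_⟩⟩
  · have := hz γ hγ i j hji.le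
    rw [map_sub, Finsupp.sub_apply, B.repr_self, Finsupp.single_eq_of_ne hji.ne', sub_zero] at this
    rw [LinearMap.toMatrix_apply]
    exact this
  · have := hz γ hγ i i le_rfl
    rw [map_sub, Finsupp.sub_apply, B.repr_self, Finsupp.single_eq_same, sub_eq_zero] at this
    rw [LinearMap.toMatrix_apply]
    exact this

theorem ProductSplitting.hasUnipotentHolonomy [FiniteDimensional ℝ V] {v : V} {E F : Submodule ℝ V}
    (h : ProductSplitting Γ v E F) (hu : HasUnipotentHolonomy Γ) :
    HasUnipotentHolonomy (restrictGroup Γ v F) := by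
  refine hasUnipotentHolonomy_of_fixed_mod fun Y hY => ?_
  obtain ⟨x, hx, hxY, hxγ⟩ := hu.exists_fixed_mod F (Y.map F.subtype)
    (fun γ hγ w hw => h.linear_mem hγ hw) (fun hle => hY (by
      rw [eq_top_iff]
      rintro w -
      obtain ⟨y, hy, hyw⟩ := hle w.2
      rwa [← Subtype.ext (a1 := y) (a2 := w) hyw]))
  refine ⟨⟨x, hx⟩, fun hmem => hxY ⟨_, hmem, rfl⟩, ?_⟩
  rintro δ ⟨γ, hγ, hδ⟩
  obtain ⟨y, hy, hyx⟩ := hxγ γ hγ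
  have h1 : δ.linear ⟨x, hx⟩ - ⟨x, hx⟩ = y := Subtype.ext (by
    rw [Submodule.coe_sub, ProductSplitting.linear_eq hδ]
    exact hyx.symm)
  rwa [h1]

end Quotient

section Frames

variable {V : Type*} [NormedAddCommGroup V] [NormedSpace ℝ V]
  {ℓ : LinearMap.BilinForm ℝ V} {C : Set V} {Γ : Subgroup (V ≃ᵃ[ℝ] V)} {v v₀ v₁ : V}

theorem NullPair.mem_cone (h : NullPair ℓ v₀ v₁) {e : V} (he : 0 < ℓ e e)
    (hv₀ : v₀ ∈ timeCone ℓ e) : v₁ ∈ timeCone ℓ e := by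
  refine ⟨h.iso₁.ge, ?_⟩
  by_contra hneg
  push Not at hneg
  have := h.lorentzian.nonneg_of_mem_cone he hv₀ (w := -v₁)
    ⟨by simp [h.iso₁], by rw [map_neg]; linarith⟩
  rw [map_neg, h.pair] at this
  linarith

theorem mem_mainN {n : V} : n ∈ mainN ℓ v₀ v₁ ↔ ℓ v₀ n = 0 ∧ ℓ v₁ n = 0 := by
  have key : ∀ z : V, n ∈ ℓ.orthogonal (Submodule.span ℝ {z}) ↔ ℓ z n = 0 := fun z => by
    refine ⟨fun hn => hn z (Submodule.mem_span_singleton_self z), fun hz y hy => ?_⟩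
    obtain ⟨c, rfl⟩ := Submodule.mem_span_singleton.mp hy
    change ℓ (c • z) n = 0
    rw [map_smul, LinearMap.smul_apply, hz, smul_zero]
  rw [mainN, Submodule.mem_inf, key, key]

theorem HolonomyFrame.not_isElliptic_restrict (h : HolonomyFrame ℓ C Γ v₀ v₁) {E F : Submodule ℝ V}
    (hS : ProductSplitting Γ v E F) (hv₁ : v₁ ∈ F) : ¬ IsElliptic (restrictGroup Γ v F) := by
  intro hell
  obtain ⟨γ, hγ, hb⟩ := h.nontrivial
  obtain ⟨δ, hδ, -, hlin⟩ := hS.exists_restrict hγ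
  obtain ⟨t, ht⟩ := hell δ hδ
  have h1 := δ.apply_add 0 ⟨v₁, hv₁⟩
  rw [ht, ht, zero_add, zero_add, add_comm] at h1
  have h2 := hlin ⟨v₁, hv₁⟩
  rw [← add_left_cancel h1] at h2
  exact hb (by rw [← h2]; exact h.projN_right)

variable [FiniteDimensional ℝ V]

theorem isClosed_timeCone (ℓ : LinearMap.BilinForm ℝ V) (e : V) : IsClosed (timeCone ℓ e) :=
  (isClosed_le continuous_const (continuous_bilin ℓ continuous_id continuous_id)).inter
    (isClosed_le continuous_const (continuous_bilin ℓ continuous_const continuous_id))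

omit [FiniteDimensional ℝ V] in
/-- The nonzero isotropic vectors of the cone lie in its boundary. -/
theorem IsLorentzian.mem_frontier (h : IsLorentzian ℓ) {e w : V} (he : 0 < ℓ e e)
    (hw : w ∈ timeCone ℓ e) (hiso : ℓ w w = 0) (hne : w ≠ 0) : w ∈ frontier (timeCone ℓ e) := by
  refine ⟨subset_closure hw, fun hint => ?_⟩
  have hα : 0 < ℓ e w := hw.2.lt_of_ne' fun h0 => by linarith [h.neg_of_orth he h0 hne]
  have hc : Continuous fun t : ℝ => w - t • e := by fun_prop
  have h1 : ∀ᶠ t in 𝓝 (0 : ℝ), w - t • e ∈ timeCone ℓ e :=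
    hc.continuousAt.preimage_mem_nhds (by simpa using mem_interior_iff_mem_nhds.mp hint)
  have h2 : ∀ᶠ t in 𝓝 (0 : ℝ), t < 2 * ℓ e w / ℓ e e := gt_mem_nhds (by positivity)
  have h12 : ∀ᶠ t in 𝓝[>] (0 : ℝ), w - t • e ∈ timeCone ℓ e ∧ t < 2 * ℓ e w / ℓ e e :=
    nhdsWithin_le_nhds (h1.and h2)
  obtain ⟨t, ⟨ht1, ht2⟩, ht0⟩ := (h12.and self_mem_nhdsWithin).exists
  have ht0' : 0 < t := ht0
  rw [lt_div_iff₀ he] at ht2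
  have h3 : 0 ≤ ℓ (w - t • e) (w - t • e) := ht1.1
  simp [hiso, h.symm w e] at h3
  nlinarith

omit [FiniteDimensional ℝ V] in
/-- The boundary of the cone contains a generator of `L`. -/
theorem exists_generator_holL (hM : IsUnipotentManifold ℓ C Γ) (hne : ¬ IsElliptic Γ) :
    ∃ v₀ ∈ frontier C, Submodule.span ℝ {v₀} = holL ℓ Γ := by
  have hlor := hM.1.lorentzian
  obtain ⟨e, he, hC⟩ := hM.1.cone
  obtain ⟨z, hz, hz0⟩ := (holL ℓ Γ).ne_bot_iff.mp (holL_ne_bot hlor hM.1.isometric hM.2 hne)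
  have hiso : ℓ z z = 0 := holL_isotropic z hz z hz
  obtain ⟨v₀, hv₀, hv₀0, hv₀e⟩ : ∃ v₀ ∈ holL ℓ Γ, v₀ ≠ 0 ∧ 0 ≤ ℓ e v₀ := by
    rcases le_total 0 (ℓ e z) with h0 | h0
    · exact ⟨z, hz, hz0, h0⟩
    · exact ⟨-z, neg_mem hz, neg_ne_zero.mpr hz0, by rw [map_neg]; linarith⟩
  have hv₀i := holL_isotropic v₀ hv₀ v₀ hv₀
  refine ⟨v₀, ?_, le_antisymm (by simpa using hv₀) fun w hw => ?_⟩
  · rw [show C = timeCone ℓ e from hC]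
    exact hlor.mem_frontier he ⟨hv₀i.ge, hv₀e⟩ hv₀i hv₀0
  · obtain ⟨c, rfl⟩ := hlor.eq_smul_of_orth hv₀0 hv₀i (holL_isotropic v₀ hv₀ w hw)
      (holL_isotropic w hw w hw).ge
    exact Submodule.smul_mem _ _ (Submodule.mem_span_singleton_self v₀)

theorem exists_holonomyFrame_perp (hM : IsUnipotentManifold ℓ C Γ) (hne : ¬ IsElliptic Γ)
    (h0 : Submodule.span ℝ {v₀} = holL ℓ Γ) (v : V) :
    ∃ v₁, HolonomyFrame ℓ C Γ v₀ v₁ ∧ ∀ x ∈ logSpan Γ v, ℓ v₁ x = 0 := by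
  have hlor := hM.1.lorentzian
  have hv₀ : v₀ ∈ holL ℓ Γ := h0 ▸ Submodule.mem_span_singleton_self v₀
  have hv₀0 : v₀ ≠ 0 := by
    rintro rfl
    refine holL_ne_bot hlor hM.1.isometric hM.2 hne ?_
    rw [← h0, Submodule.span_zero_singleton]
  obtain ⟨w, hw1, hw2, -⟩ := hlor.exists_isotropic (holL_isotropic v₀ hv₀ v₀ hv₀) ⊥
    (by simp) (by simpa using hv₀0)
  obtain ⟨v₁, h1, h2, h3⟩ :=
    (holonomyFrame_of_span_eq hM hne h0 hw1 hw2).exists_perp_logSpan v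
  exact ⟨v₁, holonomyFrame_of_span_eq hM hne h0 h1 h2, h3⟩

theorem exists_isFrame (hM : IsUnipotentManifold ℓ C Γ) (hne : ¬ IsElliptic Γ) (v : V) :
    orbitTangent Γ v = logSpan Γ v ∧ ∃ v₀ v₁, IsFrame ℓ C Γ v v₀ v₁ := by
  obtain ⟨v₀, hv₀, h0⟩ := exists_generator_holL hM hne
  obtain ⟨v₁, hF, hperp⟩ := exists_holonomyFrame_perp hM hne h0 v
  have hOT := hF.orbitTangent_eq_logSpan v hperp
  exact ⟨hOT, v₀, v₁, hv₀, h0, hF.iso₁, hOT ▸ hperp, hF.pair⟩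

theorem MainData.isMainConstruction (hM : IsStrictlyCausal ℓ C Γ) {T : Submodule ℝ V}
    {a : T →ₗ[ℝ] V} (h : MainData ℓ v₀ v₁ T a) (hv₀ : v₀ ∈ frontier C)
    (hfree : ∀ (s : ℝ) (x : T), (x : V) + s • a x = 0 → x = 0) {Λ : AddSubgroup T}
    (hspan : Submodule.span ℝ (Λ : Set T) = ⊤) (hdisc : ∃ ε > 0, ∀ x ∈ Λ, ‖(x : V)‖ < ε → x = 0) :
    IsMainConstruction ℓ C v₀ v₁ T a Λ := by
  obtain ⟨e, he, hC⟩ := hM.cone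
  have hC' : C = timeCone ℓ e := hC
  refine ⟨hv₀, ?_, h.pair, fun x hx => mem_mainN.mpr ⟨h.left_T x hx, h.right_T x hx⟩,
    fun x => mem_mainN.mpr ⟨h.left_a x, h.right_a x⟩, h.a_symm, hfree, ?_, hspan⟩
  · rw [hC'] at hv₀ ⊢
    have hv₀C := (isClosed_timeCone ℓ e).frontier_subset hv₀
    refine h.lorentzian.mem_frontier he (h.mem_cone he hv₀C)
      h.iso₁ ?_
    rintro rfl
    have := h.pair
    simp at this
  · obtain ⟨ε, hε, hdisc⟩ := hdisc
    refine discreteTopology_of_isOpen_singleton_zero ?_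
    rw [Metric.isOpen_singleton_iff]
    refine ⟨ε, hε, fun x hx => Subtype.ext (hdisc x x.2 ?_)⟩
    rwa [dist_zero_right] at hx

omit [FiniteDimensional ℝ V] in
theorem MainData.isOrthProj {T : Submodule ℝ V} {a : T →ₗ[ℝ] V} (h : MainData ℓ v₀ v₁ T a)
    (p : V) (x : T) : IsOrthProj ℓ (mainN ℓ v₀ v₁) ((h.expAff p x).linear v₁) (a x) := by
  refine ⟨mem_mainN.mpr ⟨h.left_a x, h.right_a x⟩, fun w hw => ?_⟩
  obtain ⟨hw0, hw1⟩ := mem_mainN.mp hw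
  rw [h.expAff_linear, mainLambda, h.pair, one_smul]
  simp [hw0, hw1]

/-- The decomposition of the tangent space with the factor `E = U^⊥ ∩ N`. -/
theorem HolonomyFrame.productSplitting (h : HolonomyFrame ℓ C Γ v₀ v₁) {T : Submodule ℝ V}
    {a : T →ₗ[ℝ] V} (hD : MainData ℓ v₀ v₁ T a) (hT : T = orbitTangent Γ v)
    (hΓ : ∀ γ ∈ Γ, ∃ x, γ = hD.expAff v x) {E : Submodule ℝ V}
    (hE : E = ℓ.orthogonal (holU Γ v) ⊓ mainN ℓ v₀ v₁) :
    ProductSplitting Γ v E (ℓ.orthogonal E) := by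
  have hEN : ∀ x ∈ E, ℓ v₀ x = 0 ∧ ℓ v₁ x = 0 := fun x hx => mem_mainN.mp (hE ▸ hx).2
  have hEU : ∀ x ∈ E, ∀ u ∈ holU Γ v, ℓ x u = 0 := fun x hx u hu =>
    (h.symm _ _).trans ((hE ▸ hx).1 u hu)
  refine ⟨?_, fun γ hγ w hw => ?_, fun γ hγ x hx => ?_⟩
  · rw [LinearMap.BilinForm.isCompl_orthogonal_iff_disjoint h.lorentzian.isRefl,
      Submodule.disjoint_def]
    intro x hx hx'
    by_contra hne
    have := h.neg (hEN x hx).1 (hEN x hx).2 hne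
    rw [show ℓ x x = 0 from hx' x hx] at this
    exact lt_irrefl _ this
  · obtain ⟨y, rfl⟩ := hΓ γ hγ
    intro x hx
    change ℓ x _ = 0
    have h1 : (hD.expAff v y) (v + w) - v = ((hD.expAff v y).linear w - w) + w +
        ((y : V) - ((1 / 2 : ℝ) * ℓ (a y) (y : V)) • v₀) := by
      rw [AffineEquiv.apply_add, hD.expAff_base]
      abel
    have h2 : ℓ x ((hD.expAff v y).linear w - w) = 0 :=
      hEU x hx _ (Submodule.mem_sup_right (linear_sub_mem_holH hγ w))
    have h3 : ℓ x y = 0 := hEU x hx _ (Submodule.mem_sup_left (hT ▸ y.2))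
    have h4 : ℓ x w = 0 := hw x hx
    have h5 : ℓ x v₀ = 0 := (h.symm _ _).trans (hEN x hx).1
    rw [h1, map_add, map_add, h2, h4, map_sub, h3, map_smul, h5]
    simp
  · refine (mem_orthogonal_holH h.lorentzian h.causal.isometric).mp ?_ γ hγ
    exact fun u hu => (hE ▸ hx).1 u (Submodule.mem_sup_right hu)

end Frames

theorem proposition2 {V : Type*} [NormedAddCommGroup V] [NormedSpace ℝ V] [FiniteDimensional ℝ V]
    (ℓ : LinearMap.BilinForm ℝ V) (C : Set V) (Γ : Subgroup (V ≃ᵃ[ℝ] V))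
    (hM : IsUnipotentManifold ℓ C Γ) (hne : ¬ IsElliptic Γ) (v : V) :
    -- `dim L = 1`, and the holonomy group fixes `L` pointwise
    Module.finrank ℝ (holL ℓ Γ) = 1 ∧
    (∀ γ ∈ Γ, ∀ u ∈ holL ℓ Γ, γ.linear u = u) ∧
    -- admissible pairs `v₀, v₁` exist
    (∃ v₀ v₁, IsFrame ℓ C Γ v v₀ v₁) ∧
    -- `e = exp` is well defined on `T`, its values are the elements of the Zariski closure of `Γ`
    ∃ e : orbitTangent Γ v → (V ≃ᵃ[ℝ] V),
      (∀ (x : orbitTangent Γ v) h, IsOrbitExp Γ v (x : V) h ↔ h = e x) ∧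
      Set.range e = zariskiClosure Γ ∧
      -- the subgroup `Λ` of `T` which corresponds to `Γ`
      ∃ Λ : AddSubgroup (orbitTangent Γ v), (∀ x, x ∈ Λ ↔ e x ∈ Γ) ∧
      ∀ v₀ v₁, IsFrame ℓ C Γ v v₀ v₁ →
        ∀ N : Submodule ℝ V, N = ℓ.orthogonal (Submodule.span ℝ {v₁}) ⊓ holW ℓ Γ →
        -- (1)
        (∀ z, ∃! y, IsOrthProj ℓ N z y) ∧
        (∃ a : orbitTangent Γ v →ₗ[ℝ] V,
          (∀ x, IsOrthProj ℓ N ((e x).linear v₁) (a x)) ∧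
          IsMainConstruction ℓ C v₀ v₁ (orbitTangent Γ v) a Λ ∧
          (∀ x u, e x (v + u) = v + mainGamma ℓ v₀ a x u) ∧
          -- (2)
          (∀ x ∈ Λ, ∀ u, expAt Γ v (mainGamma ℓ v₀ a x u) = expAt Γ v u) ∧
          (∀ u w, expAt Γ v u = expAt Γ v w ↔ ∃ x ∈ Λ, mainGamma ℓ v₀ a x u = w) ∧
          Function.Surjective (expAt Γ v) ∧
          IsCoveringMap (expAt Γ v)) ∧
        -- (3)
        (∀ E F : Submodule ℝ V, E = ℓ.orthogonal (holU Γ v) ⊓ N → F = ℓ.orthogonal E →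
          IsCompl E F ∧
          IsUnipotentManifold (ℓ.restrict F) ((Subtype.val : F → V) ⁻¹' C)
            (restrictGroup Γ v F) ∧
          ¬ IsElliptic (restrictGroup Γ v F) ∧
          (∃ ι : FlatQuotient (restrictGroup Γ v F) → FlatQuotient Γ,
            IsEmbedding ι ∧ Set.range ι = expAt Γ v '' (F : Set V) ∧
            ∀ w : F, ι (kappa (restrictGroup Γ v F) w) = expAt Γ v (w : V)) ∧
          ∃ Φ : E × (expAt Γ v '' (F : Set V)) ≃ₜ FlatQuotient Γ,
            ∀ (x : E) (w : F), Φ (x, ⟨expAt Γ v (w : V), (w : V), w.2, rfl⟩) =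
              expAt Γ v ((x : V) + (w : V))) := by
  have hlor := hM.1.lorentzian
  have hiso := hM.1.isometric
  obtain ⟨hOT, u₀, u₁, hu⟩ := exists_isFrame hM hne v
  have hframe : ∀ v₀ v₁, IsFrame ℓ C Γ v v₀ v₁ → HolonomyFrame ℓ C Γ v₀ v₁ ∧
      ∀ x ∈ logSpan Γ v, ℓ v₁ x = 0 := fun v₀ v₁ h =>
    ⟨holonomyFrame_of_span_eq hM hne h.span_eq h.isotropic h.pairing, hOT ▸ h.perp⟩
  obtain ⟨a₀, hD₀, hΓ₀, hspan₀, -⟩ := (hframe u₀ u₁ hu).1.exists_mainData v (hframe u₀ u₁ hu).2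
    (orbitTangent Γ v) hOT
  have hZ₀ := hD₀.zariskiClosure_eq v hΓ₀ hspan₀
  refine ⟨finrank_holL hlor hiso hM.2 hne, holL_fixed hlor hiso, ⟨u₀, u₁, hu⟩, hD₀.expAff v,
    hD₀.isOrbitExp_iff hZ₀, hZ₀.symm,
    { carrier := {x | hD₀.expAff v x ∈ Γ}
      add_mem' := fun {x y} hx hy => by
        change hD₀.expAff v (x + y) ∈ Γ
        rw [hD₀.expAff_add]; exact Γ.mul_mem hx hy
      zero_mem' := by
        change hD₀.expAff v 0 ∈ Γ
        rw [hD₀.expAff_zero]; exact Γ.one_mem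
      neg_mem' := fun {x} hx => by
        change hD₀.expAff v (-x) ∈ Γ
        rw [hD₀.expAff_neg]; exact Γ.inv_mem hx }, fun x => Iff.rfl, ?_⟩
  intro v₀ v₁ hvF N hN
  obtain ⟨hF, hperp⟩ := hframe v₀ v₁ hvF
  obtain ⟨a, hD, hΓ, hspan, hfree, hdisc⟩ := hF.exists_mainData v hperp (orbitTangent Γ v) hOT
  have hZ := hD.zariskiClosure_eq v hΓ hspan
  have hexp : hD₀.expAff v = hD.expAff v := funext fun x =>
    (hD.isOrbitExp_iff hZ x _).mp ((hD₀.isOrbitExp_iff hZ₀ x _).mpr rfl)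
  have hNm : N = mainN ℓ v₀ v₁ := by
    rw [hN, holW, ← hvF.span_eq, inf_comm, mainN]
  rw [hNm]
  simp only [hexp]
  refine ⟨isOrthProj_existsUnique hlor _ fun x hx hx0 =>
    hF.neg (mem_mainN.mp hx).1 (mem_mainN.mp hx).2 hx0, ⟨a, hD.isOrthProj v, ?_,
    hD.expAff_apply_add v, ?_, ?_, expAt_surjective Γ v, hM.1.isCoveringMap_expAt v⟩, ?_⟩
  · exact hD.isMainConstruction hM.1 hvF.mem_frontier hfree hspan hdisc
  · exact fun x hx u => (kappa_eq_iff.mpr ⟨_, hx, hD.expAff_apply_add v x u⟩).symm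
  · refine fun u w => kappa_eq_iff.trans ⟨?_, ?_⟩
    · rintro ⟨γ, hγ, hγu⟩
      obtain ⟨x, rfl⟩ := hΓ γ hγ
      rw [hD.expAff_apply_add] at hγu
      exact ⟨x, hγ, add_left_cancel hγu⟩
    · rintro ⟨x, hx, rfl⟩
      exact ⟨_, hx, hD.expAff_apply_add v x u⟩
  · rintro E F hE rfl
    have hS := hF.productSplitting hD rfl hΓ hE
    have hEN : ∀ x ∈ E, ℓ v₀ x = 0 ∧ ℓ v₁ x = 0 := fun x hx => mem_mainN.mp (hE ▸ hx).2
    have hv₀ : v₀ ∈ ℓ.orthogonal E := fun x hx => (hlor.symm _ _).trans (hEN x hx).1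
    have hv₁ : v₁ ∈ ℓ.orthogonal E := fun x hx => (hlor.symm _ _).trans (hEN x hx).2
    exact ⟨hS.isCompl, ⟨hS.isStrictlyCausal hM.1 (add_mem hv₀ hv₁) hF.sum_pos,
      hS.hasUnipotentHolonomy hM.2⟩, hF.not_isElliptic_restrict hS hv₁,
      ⟨hS.embed, hS.isEmbedding_embed, hS.range_embed, hS.embed_kappa⟩,
      hS.exists_homeomorph hM.1.isCoveringMap_kappa.2⟩
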